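/- **Setting.** Let $\mathcal A$ be a countable set of actions and let $(P_\theta)_{\theta\in\Theta}$ be a family of probability measures (priors) on mean vectors $\mu=(\mu_a)_{a\in\mathcal A}\in\mathbb R^{\mathcal A}$. Let $\mathcal D$ be a Markov kernel from $\mathbb R^{\mathcal A}$ to $\mathbb R^{\mathcal A}$ with $\mathbb E_{r\sim\mathcal D(\mu)}[r_a]=\mu_a$ for all $\mu$ and $a$. A family of randomized algorithms $\mathsf{alg}(\theta)$, $\theta\in\Theta$, consists of a law $\mathcal D_{\mathrm{seed}}$ (not depending on $\theta$) of a random seed $\xi$, and of probability kernels $f_h(\cdot\mid\tau_{h-1},\xi,\theta)$ on $\mathcal A$, where $\tau_{h-1}=(a_1,r_1,\dots,a_{h-1},r_{h-1})$ is the trajectory of the past actions and observed rewards. Under $P_{\theta,\mathsf{alg}(\theta_1)}$ one draws $\mu\sim P_\theta$ and, independently, $\xi\sim\mathcal D_{\mathrm{seed}}$; at each step $h=1,\dots,H$ the action $a_h\sim f_h(\cdot\mid\tau_{h-1},\xi,\theta_1)$ and a reward vector $\mathbf r_h\sim\mathcal D(\mu)$ are drawn independently of each other, and $r_h=\mathbf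 r_{h,a_h}$ is observed. Let $$R(\theta,\mathsf{alg}(\theta_1))=E_{\theta,\mathsf{alg}(\theta_1)}\Big[\sum_{h=1}^H r_h\Big].$$ Let $P_\theta(\mu\mid\tau_{h-1})$ be any version of the posterior of the mean vector given the trajectory under the prior $P_\theta$ (it does not depend on the algorithm that generated the trajectory, and may be any distribution at trajectories outside the support), and let $P_{\mathsf{alg}(\theta)}(a_h\mid\tau_{h-1})$ be the conditional law of the next action of $\mathsf{alg}(\theta)$ given the trajectory, with the seed integrated out given $\tau_{h-1}$. Write $\mathrm{TV}(P,Q)=\sup_E|P(E)-Q(E)|$. For real $n>0$, the family $\mathsf{alg}(\cdot)$ is *$n$-Monte Carlo* on horizon $H$ if for all $\theta,\theta'\in\Theta$, all $1\le h\le H$ and all trajectories $\tau_{h-1}$ (at which both conditional laws of the action are defined) $$\mathrm{TV}\big(P_{\mathsf{alg}(\theta)}(a_h\mid\tau_{h-1}),P_{\mathsf{alg}(\theta')}(a_h\mid\tau_{h-1})\big)\le n\cdot\mathrm{TV}\big(P_\theta(\mu\mid\tau_{h-1}),P_{\theta'}(\mu\mid\tau_{h-1})\big).$$ Let $\mathrm{diam}(\mu)=\sup_a\mu_a-\inf_a\mu_a$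 and $\bar\mu=E_\theta[\mu]$. The prior $P_\theta$ is *$B$-bounded* if $P_\theta[\mathrm{diam}(\mu)\le B]=1$; *coordinate-wise $\sigma^2$-sub-Gaussian* ($\sigma>0$) if $P_\theta(|\mu_a-\bar\mu_a|\ge t)\le 2\exp(-\tfrac{t^2}{2\sigma^2})$ for all $a\in\mathcal A$, $t\ge0$; and *coordinate-wise $(\sigma^2,\nu)$-sub-Gamma* ($\sigma,\nu>0$) if $P_\theta(|\mu_a-\bar\mu_a|\ge t)\le 2\max\{\exp(-\tfrac{t^2}{2\sigma^2}),\exp(-\tfrac{t}{2\nu})\}$ for all $a\in\mathcal A$, $t\ge0$. **Theorem.** Let $\mathsf{alg}(\cdot)$ be an $n$-Monte Carlo family of algorithms on horizon $H\in\mathbb N$, let $\theta,\theta'\in\Theta$, and let $\varepsilon=\mathrm{TV}(P_\theta,P_{\theta'})$. Assume that $R(\theta,\mathsf{alg}(\theta))$ and $R(\theta,\mathsf{alg}(\theta'))$ are well defined, i.e. that the rewards $r_1,\dots,r_H$ are integrable under $P_{\theta,\mathsf{alg}(\theta)}$ and under $P_{\theta,\mathsf{alg}(\theta')}$. (a) If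 $P_\theta$ is $B$-bounded, then $$|R(\theta,\mathsf{alg}(\theta))-R(\theta,\mathsf{alg}(\theta'))|\le 2nH^2\varepsilon B.$$ (b) If $\mathcal A$ is finite and $P_\theta$ is coordinate-wise $\sigma^2$-sub-Gaussian, then $$|R(\theta,\mathsf{alg}(\theta))-R(\theta,\mathsf{alg}(\theta'))|\le 2nH^2\varepsilon\left(\mathrm{diam}(E_\theta[\mu])+\sigma\left(8+5\sqrt{\log\tfrac{|\mathcal A|^2}{\min\{1,2nH\varepsilon\}}}\right)\right).$$ (c) If $\mathcal A$ is finite and $P_\theta$ is coordinate-wise $(\sigma^2,\nu)$-sub-Gamma, then $$|R(\theta,\mathsf{alg}(\theta))-R(\theta,\mathsf{alg}(\theta'))|\le 2nH^2\varepsilon\left(\mathrm{diam}(E_\theta[\mu])+\sigma\left(8+5\sqrt{\log\tfrac{|\mathcal A|^2}{\min\{1,2nH\varepsilon\}}}\right)+\nu\left(11+7\log\tfrac{|\mathcal A|^2}{\min\{1,2nH\varepsilon\}}\right)\right).$$ (If $H\varepsilon=0$, the right-hand sides are read as $0$.) -/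

import Mathlib

open MeasureTheory ProbabilityTheory

namespace BayesBandit

/-- Total variation distance `sup_E |P(E) - Q(E)|` over measurable events. -/
noncomputable def tv {Ω : Type*} [MeasurableSpace Ω] (P Q : Measure Ω) : ℝ :=
  ⨆ E : {E : Set Ω // MeasurableSet E}, |P.real E.1 - Q.real E.1|

/-- Partial trajectories `(a₁, r₁, …, a_h, r_h)`. -/
abbrev History (A : Type*) (h : ℕ) : Type _ := Fin h → A × ℝ

/-- The first `j` steps of a partial trajectory, as seen just before step `j` (counted from `0`). -/
def History.before {A : Type*} {h : ℕ} (τ : History A h) (j : Fin h) : History A j :=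
  fun i => τ (Fin.castLE j.2.le i)

/-- A Bayesian bandit instance: priors `P_θ` over mean vectors in `ℝ^A`, and a map sending a
mean vector `μ` to a distribution of reward vectors whose mean is `μ`. -/
structure Instance (A Θ : Type*) where
  prior : Θ → Measure (A → ℝ)
  isProbabilityMeasure_prior : ∀ θ, IsProbabilityMeasure (prior θ)
  reward : Kernel (A → ℝ) (A → ℝ)
  isMarkovKernel_reward : IsMarkovKernel reward
  integrable_reward : ∀ (μ : A → ℝ) (a : A), Integrable (fun r : A → ℝ => r a) (reward μ)
  mean_reward : ∀ (μ : A → ℝ) (a : A), ∫ r, r a ∂(reward μ) = μ a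

attribute [instance] Instance.isProbabilityMeasure_prior Instance.isMarkovKernel_reward

/-- A family `alg(θ)` of randomized bandit algorithms. A seed `ξ : Ξ` is drawn from a law that does
not depend on `θ`; given the past trajectory `τ` of length `h` and the seed, the next action
is drawn from `act θ h (τ, ξ)`. -/
structure AlgFamily (A Θ Ξ : Type*) [MeasurableSpace A] [MeasurableSpace Ξ] where
  seed : Measure Ξ
  isProbabilityMeasure_seed : IsProbabilityMeasure seed
  act : Θ → (h : ℕ) → Kernel (History A h × Ξ) A
  isMarkovKernel_act : ∀ θ h, IsMarkovKernel (act θ h)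

attribute [instance] AlgFamily.isProbabilityMeasure_seed AlgFamily.isMarkovKernel_act

section Protocol

variable {A Ξ : Type*} [MeasurableSpace A] [MeasurableSpace Ξ]

/-- One step of interaction, given `((μ, ξ), τ)`: the action `a` is drawn from the policy, the reward
vector `r` is drawn independently from `D(μ)`, and `(a, r_a)` is recorded. -/
noncomputable def stepKernel (D : Kernel (A → ℝ) (A → ℝ)) {h : ℕ}
    (f : Kernel (History A h × Ξ) A) :
    Kernel (((A → ℝ) × Ξ) × History A h) (A × ℝ) :=
  ((f.comap (fun x : ((A → ℝ) × Ξ) × History A h => (x.2, x.1.2)) (by fun_prop)) ×ₖ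
    (D.comap (fun x : ((A → ℝ) × Ξ) × History A h => x.1.1) (by fun_prop))).map
      (fun y : A × (A → ℝ) => (y.1, y.2 y.1))

/-- Law of the trajectory of the first `h` steps, given the mean vector and the seed. -/
noncomputable def trajKernel (D : Kernel (A → ℝ) (A → ℝ))
    (f : (h : ℕ) → Kernel (History A h × Ξ) A) :
    (h : ℕ) → Kernel ((A → ℝ) × Ξ) (History A h)
  | 0 => Kernel.const _ (Measure.dirac Fin.elim0)
  | h + 1 => (trajKernel D f h ⊗ₖ stepKernel D (f h)).map
      (fun y : History A h × (A × ℝ) => (Fin.snoc y.1 y.2 : History A (h + 1)))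

/-- Joint law of the mean vector and of the trajectory of the first `h` steps, when the mean vector
is drawn from `P` and the seed is drawn independently of it. -/
noncomputable def jointLaw (P : Measure (A → ℝ)) (D : Kernel (A → ℝ) (A → ℝ))
    (seed : Measure Ξ) (f : (h : ℕ) → Kernel (History A h × Ξ) A) (h : ℕ) :
    Measure ((A → ℝ) × History A h) :=
  ((P.prod seed) ⊗ₘ trajKernel D f h).map
    (fun x : ((A → ℝ) × Ξ) × History A h => (x.1.1, x.2))

theorem measurable_record [Countable A] [DiscreteMeasurableSpace A] :
    Measurable (fun y : A × (A → ℝ) => (y.1, y.2 y.1)) :=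
  measurable_fst.prodMk
    (measurable_from_prod_countable_right (fun a => measurable_pi_apply a))

theorem measurable_snoc (h : ℕ) :
    Measurable
      (fun y : History A h × (A × ℝ) => (Fin.snoc y.1 y.2 : History A (h + 1))) := by
  rw [measurable_pi_iff]
  intro i
  refine Fin.lastCases ?_ (fun j => ?_) i
  · simpa using measurable_snd
  · simp only [Fin.snoc_castSucc]
    exact (measurable_pi_apply j).comp measurable_fst

instance [Countable A] [DiscreteMeasurableSpace A] (D : Kernel (A → ℝ) (A → ℝ))
    [IsMarkovKernel D] {h : ℕ} (f : Kernel (History A h × Ξ) A) [IsMarkovKernel f] :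
    IsMarkovKernel (stepKernel D f) :=
  Kernel.IsMarkovKernel.map _ measurable_record

instance isMarkovKernel_trajKernel [Countable A] [DiscreteMeasurableSpace A]
    (D : Kernel (A → ℝ) (A → ℝ)) [IsMarkovKernel D]
    (f : (h : ℕ) → Kernel (History A h × Ξ) A) [∀ h, IsMarkovKernel (f h)] (h : ℕ) :
    IsMarkovKernel (trajKernel D f h) := by
  induction h with
  | zero => unfold trajKernel; infer_instance
  | succ h ih => exact Kernel.IsMarkovKernel.map _ (measurable_snoc h)

instance [Countable A] [DiscreteMeasurableSpace A]
    (P : Measure (A → ℝ)) [IsProbabilityMeasure P] (D : Kernel (A → ℝ) (A → ℝ)) [IsMarkovKernel D]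
    (seed : Measure Ξ) [IsProbabilityMeasure seed]
    (f : (h : ℕ) → Kernel (History A h × Ξ) A) [∀ h, IsMarkovKernel (f h)] (h : ℕ) :
    IsProbabilityMeasure (jointLaw P D seed f h) :=
  Measure.isProbabilityMeasure_map (by fun_prop)

/-- The seedless policy that plays the fixed sequence of actions `a 0, a 1, …`. -/
noncomputable def openLoop (a : ℕ → A) (h : ℕ) : Kernel (History A h × Unit) A :=
  Kernel.const _ (Measure.dirac (a h))

instance (a : ℕ → A) (h : ℕ) : IsMarkovKernel (openLoop a h) := by
  unfold openLoop; infer_instance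

/-- `post` is a version of the posterior `P[μ | τ_h]`, for all `h`, under the prior `P`. As the
posterior does not depend on how the recorded actions were chosen, it is pinned down by the policies
that play a fixed sequence of actions: `post h` has to be a regular conditional distribution of the
mean vector given the trajectory under each of them. On trajectories outside the support,
`post h` may be any distribution. -/
def IsPosterior (P : Measure (A → ℝ)) (D : Kernel (A → ℝ) (A → ℝ))
    (post : (h : ℕ) → Kernel (History A h) (A → ℝ)) : Prop :=
  (∀ h, IsMarkovKernel (post h)) ∧
    ∀ (h : ℕ) (a : ℕ → A),
      (jointLaw P D (Measure.dirac ()) (openLoop a) h).map Prod.swap =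
        (jointLaw P D (Measure.dirac ()) (openLoop a) h).snd ⊗ₘ post h

end Protocol

section Algorithms

variable {A Θ Ξ : Type*} [MeasurableSpace A] [MeasurableSpace Ξ]

open scoped ENNReal

/-- Likelihood of the actions recorded in `τ`, under `alg(θ)` with seed `ξ`. -/
noncomputable def AlgFamily.seedWeight (alg : AlgFamily A Θ Ξ) (θ : Θ) {h : ℕ}
    (τ : History A h) (ξ : Ξ) : ℝ≥0∞ :=
  ∏ j : Fin h, alg.act θ j (τ.before j, ξ) {(τ j).1}

/-- Likelihood of the actions recorded in `τ`, under `alg(θ)`. -/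
noncomputable def AlgFamily.weight (alg : AlgFamily A Θ Ξ) (θ : Θ) {h : ℕ}
    (τ : History A h) : ℝ≥0∞ :=
  ∫⁻ ξ, alg.seedWeight θ τ ξ ∂alg.seed

/-- Conditional law of the seed of `alg(θ)` given the trajectory `τ`, by Bayes' formula (the
likelihood of the rewards does not involve the seed and cancels). -/
noncomputable def AlgFamily.seedPosterior (alg : AlgFamily A Θ Ξ) (θ : Θ) {h : ℕ}
    (τ : History A h) : Measure Ξ :=
  (alg.weight θ τ)⁻¹ • alg.seed.withDensity (alg.seedWeight θ τ)

/-- `P_{alg(θ)}(a_{h+1} | τ_h)`: conditional law of the next action given the trajectory. It is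
meaningful when `alg.weight θ τ ≠ 0`. If the seed is not used, it is `alg.act θ h (τ, ·)`. -/
noncomputable def AlgFamily.actionLaw (alg : AlgFamily A Θ Ξ) (θ : Θ) {h : ℕ}
    (τ : History A h) : Measure A :=
  (alg.seedPosterior θ τ).bind (fun ξ => alg.act θ h (τ, ξ))

/-- The family `alg(·)` is `n`-Monte Carlo on horizon `H`, with respect to the posteriors `post θ`.
The inequality is asked for at the trajectories at which both conditional laws of the next action
are defined. -/
def AlgFamily.IsMonteCarlo (alg : AlgFamily A Θ Ξ)
    (post : Θ → (h : ℕ) → Kernel (History A h) (A → ℝ)) (H : ℕ) (n : ℝ) : Prop :=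
  ∀ (θ θ' : Θ) (h : ℕ), h < H → ∀ τ : History A h,
    alg.weight θ τ ≠ 0 → alg.weight θ' τ ≠ 0 →
      tv (alg.actionLaw θ τ) (alg.actionLaw θ' τ) ≤ n * tv (post θ h τ) (post θ' h τ)

/-- The law `P_{θ, alg(θ₁)}` of the mean vector and of the trajectory of `H` steps. -/
noncomputable def Instance.law (I : Instance A Θ) (alg : AlgFamily A Θ Ξ) (θ θ₁ : Θ)
    (H : ℕ) : Measure ((A → ℝ) × History A H) :=
  jointLaw (I.prior θ) I.reward alg.seed (alg.act θ₁) H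

/-- The expected cumulative reward `R(θ, alg(θ₁)) = E_{θ, alg(θ₁)}[r₁ + ⋯ + r_H]`. -/
noncomputable def Instance.expReward (I : Instance A Θ) (alg : AlgFamily A Θ Ξ) (θ θ₁ : Θ)
    (H : ℕ) : ℝ :=
  ∫ x, ∑ h : Fin H, (x.2 h).2 ∂(I.law alg θ θ₁ H)

/-- The rewards `r₁, …, r_H` are integrable under `P_{θ, alg(θ₁)}`, so that `R(θ, alg(θ₁))` exists. -/
def Instance.RewardIntegrable (I : Instance A Θ) (alg : AlgFamily A Θ Ξ) (θ θ₁ : Θ)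
    (H : ℕ) : Prop :=
  ∀ h : Fin H, Integrable (fun x : (A → ℝ) × History A H => (x.2 h).2) (I.law alg θ θ₁ H)

end Algorithms

section Tails

variable {A : Type*}

/-- `diam(μ) = sup_a μ_a - inf_a μ_a`, possibly infinite. -/
noncomputable def diam (μ : A → ℝ) : EReal :=
  (⨆ a, (μ a : EReal)) - ⨅ a, (μ a : EReal)

/-- The prior mean `E[μ]`. -/
noncomputable def meanVec (P : Measure (A → ℝ)) : A → ℝ := fun a => ∫ μ, μ a ∂P

/-- `B`-bounded prior. -/
def IsBounded (P : Measure (A → ℝ)) (B : ℝ) : Prop :=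
  ∀ᵐ μ ∂P, diam μ ≤ (B : EReal)

/-- Coordinate-wise `σ²`-sub-Gaussian prior. (The tail bound forces each coordinate to be
integrable.) -/
def IsSubGaussian (P : Measure (A → ℝ)) (σ : ℝ) : Prop :=
  ∀ (a : A) (t : ℝ), 0 ≤ t →
    P.real {μ | t ≤ |μ a - meanVec P a|} ≤ 2 * Real.exp (-t ^ 2 / (2 * σ ^ 2))

/-- Coordinate-wise `(σ², ν)`-sub-Gamma prior. -/
def IsSubGamma (P : Measure (A → ℝ)) (σ ν : ℝ) : Prop :=
  ∀ (a : A) (t : ℝ), 0 ≤ t →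
    P.real {μ | t ≤ |μ a - meanVec P a|} ≤
      2 * max (Real.exp (-t ^ 2 / (2 * σ ^ 2))) (Real.exp (-t / (2 * ν)))

end Tails

end BayesBandit

/-!
Fix the prior `P_θ` and compare the laws of the mean vector and the trajectory under `alg(θ)` and
`alg(θ')`. Both are absolutely continuous with respect to one reference law, in which actions are
counted rather than drawn (`baseLaw`), and the densities are the likelihoods `W_θ` and `W_θ'` of
the recorded actions, averaged over the seed (`lintegral_jointLaw`). The densities depend on the
trajectory alone and gain the factor `P_{alg(θ)}(a | τ)` at each step (`AlgFamily.weight_snoc`).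

The common mass `∫ min(W_θ, W_θ')` starts at `1`. A step multiplies the densities by two
conditional laws of the action at distance at most `n · TV(P_θ(μ | τ), P_θ'(μ | τ))`, and on
average over trajectories of `alg(θ)` the two posteriors are at distance at most `2ε`, by the
triangle inequality and because running the algorithm is a Markov kernel applied to the prior
(`AlgFamily.lintegral_weight_mul_posterior_sub_le`). So a step loses at most `2nε`
(`AlgFamily.overlap_le_succ`), and `∫ (W_θ - W_θ')⁺ ≤ 2nHε` after `H` steps. Where one of the
likelihoods vanishes there is no common mass to lose, so the conditional laws are not needed
there.

A reward may be replaced by the mean `μ_a` of the action played (`integral_reward_eq`), and, the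
law of `μ` being the same under both algorithms, by `μ_a - inf μ`, which lies between `0` and
`diam μ`. Hence the expected total rewards differ by at most `H · ∫ diam(μ) (W_θ - W_θ')⁺`
(`abs_expReward_sub_le`). This settles bounded priors. For sub-Gamma priors, the excess density
has mass at most `δ = min(1, 2nHε)` and its `μ`-marginal is at most `P_θ`, so it is worst to put
it where the deviations are large; cutting the deviations at the level which each coordinate
exceeds with probability of order `δ / |A|` gives the bound (`IsSubGamma.exists_spread_bound`). A
sub-Gaussian prior is `(σ², ν)`-sub-Gamma for every `ν > 0`.
-/

namespace BayesBandit

open scoped ENNReal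

/-! ### Total variation -/

section TotalVariation

variable {Ω : Type*} [MeasurableSpace Ω]

theorem bddAbove_tv (P Q : Measure Ω) [IsProbabilityMeasure P] [IsProbabilityMeasure Q] :
    BddAbove (Set.range fun E : {E : Set Ω // MeasurableSet E} => |P.real E.1 - Q.real E.1|) := by
  refine ⟨1, ?_⟩
  rintro _ ⟨E, rfl⟩
  rw [abs_le]
  have h1 := measureReal_nonneg (μ := P) (s := E.1)
  have h2 := measureReal_nonneg (μ := Q) (s := E.1)
  have h3 := measureReal_le_one (μ := P) (s := E.1)
  have h4 := measureReal_le_one (μ := Q) (s := E.1)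
  constructor <;> linarith

theorem tv_nonneg (P Q : Measure Ω) : 0 ≤ tv P Q :=
  Real.iSup_nonneg fun _ => abs_nonneg _

theorem tv_comm (P Q : Measure Ω) : tv P Q = tv Q P := by
  unfold tv
  simp_rw [abs_sub_comm]

theorem measure_le_add_tv (P Q : Measure Ω) [IsProbabilityMeasure P] [IsProbabilityMeasure Q]
    {E : Set Ω} (hE : MeasurableSet E) : P E ≤ Q E + ENNReal.ofReal (tv P Q) := by
  have h := le_ciSup (bddAbove_tv P Q) ⟨E, hE⟩
  have h' : P.real E ≤ Q.real E + tv P Q := by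
    have := (le_abs_self _).trans h
    simp only [tv] at this ⊢
    linarith
  rw [← ofReal_measureReal (μ := P), ← ofReal_measureReal (μ := Q),
    ← ENNReal.ofReal_add measureReal_nonneg (tv_nonneg P Q)]
  exact ENNReal.ofReal_le_ofReal h'

/-- The total variation distance dominates differences of expectations of `[0, 1]`-valued
functions: by the layer cake formula they are averages over events. -/
theorem lintegral_le_add_tv (P Q : Measure Ω) [IsProbabilityMeasure P] [IsProbabilityMeasure Q]
    {f : Ω → ℝ≥0∞} (hf : Measurable f) (hf1 : ∀ x, f x ≤ 1) :
    ∫⁻ x, f x ∂P ≤ ∫⁻ x, f x ∂Q + ENNReal.ofReal (tv P Q) := by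
  have key : ∀ (ν : Measure Ω) [IsProbabilityMeasure ν],
      ∫⁻ x, f x ∂ν = ∫⁻ t in Set.Ioc (0 : ℝ) 1, ν {x | t ≤ (f x).toReal} := by
    intro ν _
    have h1 : ∫⁻ x, f x ∂ν = ∫⁻ x, ENNReal.ofReal (f x).toReal ∂ν := by
      refine lintegral_congr fun x => ?_
      rw [ENNReal.ofReal_toReal ((hf1 x).trans_lt ENNReal.one_lt_top).ne]
    rw [h1, lintegral_eq_lintegral_meas_le ν (Filter.Eventually.of_forall fun _ =>
      ENNReal.toReal_nonneg) hf.ennreal_toReal.aemeasurable]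
    rw [← lintegral_indicator measurableSet_Ioi, ← lintegral_indicator measurableSet_Ioc]
    refine lintegral_congr fun t => ?_
    by_cases ht : t ≤ 1
    · simp [Set.indicator, ht]
    · have : {x | t ≤ (f x).toReal} = ∅ := by
        ext x
        simp only [Set.mem_ofPred_eq, Set.mem_empty_iff_false, iff_false, not_le]
        exact (ENNReal.toReal_mono ENNReal.one_ne_top (hf1 x)).trans_lt (by simpa using ht)
      simp [Set.indicator, this]
  rw [key P, key Q]
  calc ∫⁻ t in Set.Ioc (0 : ℝ) 1, P {x | t ≤ (f x).toReal}
      ≤ ∫⁻ t in Set.Ioc (0 : ℝ) 1, (Q {x | t ≤ (f x).toReal} + ENNReal.ofReal (tv P Q)) :=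
        lintegral_mono fun t => measure_le_add_tv P Q
          (measurableSet_le measurable_const hf.ennreal_toReal)
    _ = _ := by
        rw [lintegral_add_right _ measurable_const]
        simp

/-- A Hahn set of `P - Q` realizes the total variation distance. -/
theorem tv_le_of_hahn (P Q : Measure Ω) [IsProbabilityMeasure P] [IsProbabilityMeasure Q]
    {S : Set Ω} (hS : MeasurableSet S)
    (h1 : ∀ E, MeasurableSet E → E ⊆ S → Q E ≤ P E)
    (h2 : ∀ E, MeasurableSet E → E ⊆ Sᶜ → P E ≤ Q E) :
    tv P Q ≤ P.real S - Q.real S := by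
  have one : ∀ E, MeasurableSet E → P.real E - Q.real E ≤ P.real S - Q.real S := by
    intro E hE
    have e1 := ENNReal.toReal_mono (measure_ne_top P _) (h1 (S \ E) (hS.diff hE) Set.sdiff_subset)
    have e2 := ENNReal.toReal_mono (measure_ne_top Q _) (h2 (E \ S) (hE.diff hS) fun x hx => hx.2)
    have a1 := measureReal_inter_add_sdiff (μ := P) (s := S) hE
    have a2 := measureReal_inter_add_sdiff (μ := Q) (s := S) hE
    have a3 := measureReal_inter_add_sdiff (μ := P) (s := E) hS
    have a4 := measureReal_inter_add_sdiff (μ := Q) (s := E) hS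
    rw [Set.inter_comm] at a3 a4
    simp only [Measure.real] at *
    linarith
  have : Nonempty {E : Set Ω // MeasurableSet E} := ⟨⟨∅, MeasurableSet.empty⟩⟩
  refine ciSup_le fun E => ?_
  rw [abs_le]
  refine ⟨?_, one _ E.2⟩
  have h := one _ E.2.compl
  rw [probReal_compl_eq_one_sub E.2, probReal_compl_eq_one_sub E.2] at h
  linarith

/-- Two Markov kernels into a countably generated space have Hahn sets that depend measurably on the
parameter: compare their densities with respect to the sum of the kernels. -/
theorem exists_measurable_hahn {α : Type*} [MeasurableSpace α]
    [MeasurableSpace.CountableOrCountablyGenerated α Ω]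
    (κ η : Kernel α Ω) [IsMarkovKernel κ] [IsMarkovKernel η] :
    ∃ S : Set (α × Ω), MeasurableSet S ∧ ∀ a,
      η a (Prod.mk a ⁻¹' S) ≤ κ a (Prod.mk a ⁻¹' S) ∧
      ENNReal.ofReal (tv (κ a) (η a)) ≤ κ a (Prod.mk a ⁻¹' S) - η a (Prod.mk a ⁻¹' S) := by
  let S : Set (α × Ω) :=
    {p | Kernel.rnDeriv η (κ + η) p.1 p.2 ≤ Kernel.rnDeriv κ (κ + η) p.1 p.2}
  have hS : MeasurableSet S :=
    measurableSet_le (Kernel.measurable_rnDeriv _ _) (Kernel.measurable_rnDeriv _ _)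
  refine ⟨S, hS, fun a => ?_⟩
  have hκ : κ a ≪ (κ + η) a := by
    rw [add_apply]; exact Measure.le_add_right le_rfl |>.absolutelyContinuous
  have hη : η a ≪ (κ + η) a := by
    rw [add_apply]; exact Measure.le_add_left le_rfl |>.absolutelyContinuous
  have hSa : MeasurableSet (Prod.mk a ⁻¹' S) := measurable_prodMk_left hS
  have h1 : ∀ E, MeasurableSet E → E ⊆ Prod.mk a ⁻¹' S → η a E ≤ κ a E := by
    intro E hE hES
    rw [← Kernel.setLIntegral_rnDeriv hκ hE, ← Kernel.setLIntegral_rnDeriv hη hE]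
    exact setLIntegral_mono' hE fun x hx => hES hx
  have h2 : ∀ E, MeasurableSet E → E ⊆ (Prod.mk a ⁻¹' S)ᶜ → κ a E ≤ η a E := by
    intro E hE hES
    rw [← Kernel.setLIntegral_rnDeriv hκ hE, ← Kernel.setLIntegral_rnDeriv hη hE]
    exact setLIntegral_mono' hE fun x hx => (le_total _ _).resolve_left (hES hx)
  refine ⟨h1 _ hSa subset_rfl, ?_⟩
  refine (ENNReal.ofReal_le_ofReal (tv_le_of_hahn _ _ hSa h1 h2)).trans ?_
  rw [ENNReal.ofReal_sub _ measureReal_nonneg, ofReal_measureReal, ofReal_measureReal]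

/-- Two laws on a countable set can be coupled so as to agree with probability at least
`1 - tv`: the common mass of the two laws is at least that. -/
theorem one_le_tsum_min_add_tv {A : Type*} [Countable A] [MeasurableSpace A]
    [DiscreteMeasurableSpace A] (P Q : Measure A) [IsProbabilityMeasure P]
    [IsProbabilityMeasure Q] :
    1 ≤ ∑' a, min (P {a}) (Q {a}) + ENNReal.ofReal (tv P Q) := by
  classical
  let S : Set A := {a | Q {a} ≤ P {a}}
  have hsum : ∀ (R : Measure A) (T : Set A), R T = ∑' a, T.indicator (fun a => R {a}) a := by
    intro R T
    have h := lintegral_countable' (μ := R) (T.indicator fun _ => (1 : ℝ≥0∞))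
    rw [lintegral_indicator_const (MeasurableSet.of_discrete), one_mul] at h
    rw [h]
    refine tsum_congr fun a => ?_
    by_cases ha : a ∈ T <;> simp [ha]
  calc (1 : ℝ≥0∞) = P S + P Sᶜ := (prob_add_prob_compl MeasurableSet.of_discrete).symm
    _ ≤ Q S + ENNReal.ofReal (tv P Q) + P Sᶜ := by
        gcongr; exact measure_le_add_tv P Q MeasurableSet.of_discrete
    _ = (Q S + P Sᶜ) + ENNReal.ofReal (tv P Q) := by ring
    _ = _ := by
        rw [hsum Q, hsum P, ← ENNReal.tsum_add]
        congr 1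
        refine tsum_congr fun a => ?_
        by_cases ha : a ∈ S
        · simp [ha, min_eq_right (show Q {a} ≤ P {a} from ha)]
        · simp [ha, min_eq_left (not_le.1 (show ¬ Q {a} ≤ P {a} from ha)).le]

end TotalVariation

/-! ### The law of a trajectory as a density -/

theorem before_snoc_castSucc {A : Type*} {h : ℕ} (τ : History A h) (y : A × ℝ) (j : Fin h) :
    History.before (Fin.snoc τ y : History A (h + 1)) j.castSucc = τ.before j := by
  funext i
  exact Fin.snoc_castSucc (α := fun _ => A × ℝ) y τ (Fin.castLE j.2.le i)

theorem before_snoc_last {A : Type*} {h : ℕ} (τ : History A h) (y : A × ℝ) :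
    History.before (Fin.snoc τ y : History A (h + 1)) (Fin.last h) = τ := by
  funext i
  exact Fin.snoc_castSucc (α := fun _ => A × ℝ) y τ i

section Density
variable {A Ξ : Type*} [MeasurableSpace A] [MeasurableSpace Ξ]

theorem measurable_before {h : ℕ} (j : Fin h) :
    Measurable (fun τ : History A h => τ.before j) :=
  measurable_pi_iff.2 fun _ => measurable_pi_apply _

theorem measurable_reward (a : A) : Measurable (fun r : A → ℝ => (a, r a)) :=
  measurable_const.prodMk (measurable_pi_apply a)

/-- Reference kernel for one step: counting measure on the action, and the reward of that action
drawn from `D(μ)`. -/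
noncomputable def baseStep [Countable A] (D : Kernel (A → ℝ) (A → ℝ)) : Kernel (A → ℝ) (A × ℝ) :=
  Kernel.sum fun a : A => D.map fun r => (a, r a)

/-- Reference kernel for trajectories: the `h`-fold product of `baseStep`. It is the law of the
trajectory given the mean vector, with the likelihood of the actions left out. -/
noncomputable def baseTraj [Countable A] (D : Kernel (A → ℝ) (A → ℝ)) :
    (h : ℕ) → Kernel (A → ℝ) (History A h)
  | 0 => Kernel.const _ (Measure.dirac Fin.elim0)
  | h + 1 => (baseTraj D h ⊗ₖ (baseStep D).comap Prod.fst measurable_fst).map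
      (fun y : History A h × (A × ℝ) => (Fin.snoc y.1 y.2 : History A (h + 1)))

/-- Reference law of the mean vector and the trajectory. -/
noncomputable def baseLaw [Countable A] (P : Measure (A → ℝ)) (D : Kernel (A → ℝ) (A → ℝ)) (h : ℕ) :
    Measure ((A → ℝ) × History A h) :=
  P ⊗ₘ baseTraj D h

/-- Likelihood of the recorded actions under the policy `f` with seed `ξ`. -/
noncomputable def likelihood (f : (h : ℕ) → Kernel (History A h × Ξ) A) {h : ℕ}
    (τ : History A h) (ξ : Ξ) : ℝ≥0∞ :=
  ∏ j : Fin h, f j (τ.before j, ξ) {(τ j).1}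

theorem likelihood_snoc (f : (h : ℕ) → Kernel (History A h × Ξ) A) {h : ℕ}
    (τ : History A h) (y : A × ℝ) (ξ : Ξ) :
    likelihood f (Fin.snoc τ y : History A (h + 1)) ξ =
      likelihood f τ ξ * f h (τ, ξ) {y.1} := by
  unfold likelihood
  rw [Fin.prod_univ_castSucc]
  congr 1
  · refine Finset.prod_congr rfl fun j _ => ?_
    rw [before_snoc_castSucc]
    simp
  · rw [before_snoc_last]
    simp

theorem likelihood_le_one (f : (h : ℕ) → Kernel (History A h × Ξ) A)
    [∀ h, IsMarkovKernel (f h)] {h : ℕ} (τ : History A h) (ξ : Ξ) : likelihood f τ ξ ≤ 1 :=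
  Finset.prod_le_one' fun _ _ => prob_le_one

variable [Countable A]

theorem lintegral_baseStep (D : Kernel (A → ℝ) (A → ℝ)) (μ : A → ℝ) {g : A × ℝ → ℝ≥0∞}
    (hg : Measurable g) :
    ∫⁻ y, g y ∂(baseStep D μ) = ∑' a, ∫⁻ r, g (a, r a) ∂(D μ) := by
  unfold baseStep
  rw [Kernel.sum_apply, lintegral_sum_measure]
  refine tsum_congr fun a => ?_
  rw [Kernel.lintegral_map _ (measurable_reward a) _ hg]

instance (D : Kernel (A → ℝ) (A → ℝ)) [IsMarkovKernel D] : IsSFiniteKernel (baseStep D) := by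
  unfold baseStep
  infer_instance

instance isSFiniteKernel_baseTraj (D : Kernel (A → ℝ) (A → ℝ)) [IsMarkovKernel D] (h : ℕ) :
    IsSFiniteKernel (baseTraj D h) := by
  induction h with
  | zero => unfold baseTraj; infer_instance
  | succ h ih => unfold baseTraj; infer_instance

instance (P : Measure (A → ℝ)) [IsProbabilityMeasure P] (D : Kernel (A → ℝ) (A → ℝ))
    [IsMarkovKernel D] (h : ℕ) : SFinite (baseLaw P D h) := by
  unfold baseLaw; infer_instance

theorem lintegral_baseTraj_succ (D : Kernel (A → ℝ) (A → ℝ)) [IsMarkovKernel D] (μ : A → ℝ)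
    (h : ℕ) {g : History A (h + 1) → ℝ≥0∞} (hg : Measurable g) :
    ∫⁻ τ, g τ ∂(baseTraj D (h + 1) μ) =
      ∫⁻ τ, ∑' a, ∫⁻ r, g (Fin.snoc τ (a, r a)) ∂(D μ) ∂(baseTraj D h μ) := by
  have hgs : Measurable (fun y : History A h × (A × ℝ) => g (Fin.snoc y.1 y.2)) :=
    hg.comp (measurable_snoc h)
  rw [baseTraj, Kernel.lintegral_map _ (measurable_snoc h) _ hg,
    Kernel.lintegral_compProd _ _ _ hgs]
  refine lintegral_congr fun τ => ?_
  rw [Kernel.comap_apply]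
  exact lintegral_baseStep D μ
    (hgs.comp measurable_prodMk_left)

variable [DiscreteMeasurableSpace A]

theorem measurable_likelihood (f : (h : ℕ) → Kernel (History A h × Ξ) A) (h : ℕ) :
    Measurable (fun x : History A h × Ξ => likelihood f x.1 x.2) := by
  unfold likelihood
  refine Finset.measurable_prod _ fun j _ => ?_
  have h1 : Measurable (fun z : A × (History A j × Ξ) => f j z.2 {z.1}) :=
    measurable_from_prod_countable_right fun a =>
      (f j).measurable_coe (MeasurableSet.singleton a)
  exact h1.comp ((measurable_fst.comp ((measurable_pi_apply j).comp measurable_fst)).prodMk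
    (((measurable_before j).comp measurable_fst).prodMk measurable_snd))

theorem lintegral_stepKernel (D : Kernel (A → ℝ) (A → ℝ)) [IsMarkovKernel D] {h : ℕ}
    (f : Kernel (History A h × Ξ) A) [IsMarkovKernel f] (μ : A → ℝ) (ξ : Ξ) (τ : History A h)
    {g : A × ℝ → ℝ≥0∞} (hg : Measurable g) :
    ∫⁻ y, g y ∂(stepKernel D f ((μ, ξ), τ)) =
      ∑' a, (∫⁻ r, g (a, r a) ∂(D μ)) * f (τ, ξ) {a} := by
  have hgr : Measurable (fun y : A × (A → ℝ) => g (y.1, y.2 y.1)) :=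
    hg.comp measurable_record
  unfold stepKernel
  rw [Kernel.lintegral_map _ measurable_record _ hg, Kernel.prod_apply,
    lintegral_prod _ hgr.aemeasurable, lintegral_countable']
  rfl

/-- Given the mean vector and the seed, the law of the trajectory has the likelihood of the actions
as its density with respect to the reference kernel. -/
theorem lintegral_trajKernel (D : Kernel (A → ℝ) (A → ℝ)) [IsMarkovKernel D]
    (f : (h : ℕ) → Kernel (History A h × Ξ) A) [∀ h, IsMarkovKernel (f h)]
    (μ : A → ℝ) (ξ : Ξ) (h : ℕ) {g : History A h → ℝ≥0∞} (hg : Measurable g) :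
    ∫⁻ τ, g τ ∂(trajKernel D f h (μ, ξ)) =
      ∫⁻ τ, likelihood f τ ξ * g τ ∂(baseTraj D h μ) := by
  induction h with
  | zero => simp [trajKernel, baseTraj, likelihood]
  | succ h ih =>
    have hl (k : ℕ) : Measurable (fun τ : History A k => likelihood f τ ξ) :=
      (measurable_likelihood f k).comp measurable_prodMk_right
    have hgs : Measurable (fun y : History A h × (A × ℝ) => g (Fin.snoc y.1 y.2)) :=
      hg.comp (measurable_snoc h)
    have hlg : Measurable (fun τ : History A (h + 1) => likelihood f τ ξ * g τ) := (hl _).mul hg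
    have hstep : Measurable (fun τ : History A h =>
        ∫⁻ y, g (Fin.snoc τ y) ∂(stepKernel D (f h) ((μ, ξ), τ))) :=
      hgs.lintegral_kernel_prod_right'
        (κ := (stepKernel D (f h)).comap (fun τ => ((μ, ξ), τ)) measurable_prodMk_left)
    rw [lintegral_baseTraj_succ D μ h hlg, trajKernel,
      Kernel.lintegral_map _ (measurable_snoc h) _ hg, Kernel.lintegral_compProd _ _ _ hgs,
      ih hstep]
    refine lintegral_congr fun τ => ?_
    have hgτ : Measurable fun y : A × ℝ => g (Fin.snoc τ y) :=
      hgs.comp measurable_prodMk_left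
    rw [lintegral_stepKernel D (f h) μ ξ τ hgτ, ← ENNReal.tsum_mul_left]
    refine tsum_congr fun a => ?_
    simp_rw [likelihood_snoc]
    have hgr : Measurable fun r : A → ℝ => g (Fin.snoc τ (a, r a)) :=
      hgτ.comp (measurable_reward a)
    rw [lintegral_const_mul _ hgr]
    ring

/-- Likelihood of the recorded actions under the policy `f`, averaged over the seed. -/
noncomputable def weight (seed : Measure Ξ) (f : (h : ℕ) → Kernel (History A h × Ξ) A) {h : ℕ}
    (τ : History A h) : ℝ≥0∞ :=
  ∫⁻ ξ, likelihood f τ ξ ∂seed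

theorem measurable_weight (seed : Measure Ξ) [SFinite seed]
    (f : (h : ℕ) → Kernel (History A h × Ξ) A) (h : ℕ) :
    Measurable (fun τ : History A h => weight seed f τ) :=
  (measurable_likelihood f h).lintegral_prod_right'

/-- The law of the mean vector and the trajectory has the averaged likelihood of the actions as its
density with respect to the reference law. -/
theorem lintegral_jointLaw (P : Measure (A → ℝ)) [IsProbabilityMeasure P]
    (D : Kernel (A → ℝ) (A → ℝ)) [IsMarkovKernel D]
    (seed : Measure Ξ) [IsProbabilityMeasure seed]
    (f : (h : ℕ) → Kernel (History A h × Ξ) A) [∀ h, IsMarkovKernel (f h)] (h : ℕ)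
    {g : (A → ℝ) × History A h → ℝ≥0∞} (hg : Measurable g) :
    ∫⁻ x, g x ∂(jointLaw P D seed f h) =
      ∫⁻ x, weight seed f x.2 * g x ∂(baseLaw P D h) := by
  have hm : Measurable (fun x : ((A → ℝ) × Ξ) × History A h => (x.1.1, x.2)) := by fun_prop
  have hw : Measurable (fun x : (A → ℝ) × History A h => weight seed f x.2 * g x) :=
    ((measurable_weight seed f h).comp measurable_snd).mul hg
  have hgm : Measurable (fun x : ((A → ℝ) × Ξ) × History A h => g (x.1.1, x.2)) := hg.comp hm
  rw [jointLaw, baseLaw, lintegral_map hg hm, Measure.lintegral_compProd hgm,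
    Measure.lintegral_compProd hw,
    lintegral_prod _ (hgm.lintegral_kernel_prod_right').aemeasurable]
  refine lintegral_congr fun μ => ?_
  have hgμ : Measurable fun τ : History A h => g (μ, τ) := hg.comp measurable_prodMk_left
  simp_rw [lintegral_trajKernel D f μ _ h hgμ]
  rw [lintegral_lintegral_swap]
  · refine lintegral_congr fun τ => ?_
    rw [weight, lintegral_mul_const]
    exact (measurable_likelihood f h).comp measurable_prodMk_left
  · refine Measurable.aemeasurable ?_
    exact ((measurable_likelihood f h).comp measurable_swap).mul (hgμ.comp measurable_snd)

end Density

/-! ### Posterior of the mean vector and conditional law of the next action -/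

section Posterior
variable {A : Type*} [MeasurableSpace A] [Countable A] [DiscreteMeasurableSpace A]

theorem weight_openLoop (a : ℕ → A) {h : ℕ} (τ : History A h) [Decidable (∀ j, (τ j).1 = a j)] :
    weight (Measure.dirac ()) (openLoop a) τ = if ∀ j, (τ j).1 = a j then 1 else 0 := by
  classical
  simp only [weight, likelihood, openLoop, Kernel.const_apply, lintegral_dirac]
  split_ifs with hτ
  · exact Finset.prod_eq_one fun j _ => by simp [hτ j]
  · obtain ⟨j, hj⟩ := not_forall.1 hτ
    exact Finset.prod_eq_zero (Finset.mem_univ j) (by simp [Ne.symm hj])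

/-- The fixed action sequences partition the space of trajectories. -/
theorem tsum_weight_openLoop [Nonempty A] {h : ℕ} (τ : History A h) :
    ∑' α : Fin h → A, weight (Measure.dirac ())
      (openLoop fun k => if hk : k < h then α ⟨k, hk⟩ else Classical.arbitrary A) τ = 1 := by
  classical
  simp_rw [weight_openLoop]
  rw [tsum_eq_single (fun j => (τ j).1)]
  · simp
  · intro α hα
    rw [if_neg]
    intro h'
    exact hα (funext fun j => by simpa using (h' j).symm)

/-- Under the reference law, too, the posterior is the conditional distribution of the mean vector
given the trajectory: sum its defining property over all fixed action sequences. -/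
theorem IsPosterior.lintegral_baseLaw [Nonempty A] {P : Measure (A → ℝ)} [IsProbabilityMeasure P]
    {D : Kernel (A → ℝ) (A → ℝ)} [IsMarkovKernel D]
    {post : (h : ℕ) → Kernel (History A h) (A → ℝ)} (hpost : IsPosterior P D post) (h : ℕ)
    {g : (A → ℝ) × History A h → ℝ≥0∞} (hg : Measurable g) :
    ∫⁻ x, g x ∂(baseLaw P D h) = ∫⁻ x, ∫⁻ μ, g (μ, x.2) ∂(post h x.2) ∂(baseLaw P D h) := by
  have := hpost.1
  -- Only the first `h` actions matter; the sequence is continued arbitrarily.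
  let F : (Fin h → A) → (h : ℕ) → Kernel (History A h × Unit) A := fun α =>
    openLoop fun k => if hk : k < h then α ⟨k, hk⟩ else Classical.arbitrary A
  have hF (α) : ∀ k, IsMarkovKernel (F α k) := fun k => by dsimp only [F]; infer_instance
  have split : ∀ {g : (A → ℝ) × History A h → ℝ≥0∞}, Measurable g →
      ∫⁻ x, g x ∂(baseLaw P D h) =
        ∑' α, ∫⁻ x, g x ∂(jointLaw P D (Measure.dirac ()) (F α) h) := by
    intro g hg
    have hw (α) : Measurable fun x : (A → ℝ) × History A h =>
        weight (Measure.dirac ()) (F α) x.2 * g x :=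
      ((measurable_weight _ _ h).comp measurable_snd).mul hg
    simp_rw [lintegral_jointLaw P D _ (F _) h hg]
    rw [← lintegral_tsum fun α => (hw α).aemeasurable]
    refine lintegral_congr fun x => ?_
    rw [ENNReal.tsum_mul_right, tsum_weight_openLoop, one_mul]
  have hg' : Measurable fun z : History A h × (A → ℝ) => g (z.2, z.1) := hg.comp measurable_swap
  have hint : Measurable fun τ : History A h => ∫⁻ μ, g (μ, τ) ∂(post h τ) :=
    hg'.lintegral_kernel_prod_right'
  have hint' : Measurable fun x : (A → ℝ) × History A h => ∫⁻ μ, g (μ, x.2) ∂(post h x.2) :=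
    hint.comp measurable_snd
  rw [split hg, split hint']
  refine tsum_congr fun α => ?_
  have hα := congrArg (fun ν => ∫⁻ z, g (z.2, z.1) ∂ν) (hpost.2 h
    fun k => if hk : k < h then α ⟨k, hk⟩ else Classical.arbitrary A)
  rw [lintegral_map hg' measurable_swap, Measure.lintegral_compProd hg', Measure.snd,
    lintegral_map hint measurable_snd] at hα
  exact hα

end Posterior

section Weights
variable {A Θ Ξ : Type*} [MeasurableSpace A] [MeasurableSpace Ξ]

/-- A Markov kernel into the actions exists, so there are actions. -/
theorem AlgFamily.nonempty_action (alg : AlgFamily A Θ Ξ) (θ : Θ) : Nonempty A := by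
  obtain ⟨ξ⟩ := nonempty_of_isProbabilityMeasure alg.seed
  exact nonempty_of_isProbabilityMeasure (alg.act θ 0 (Fin.elim0, ξ))

theorem AlgFamily.weight_eq (alg : AlgFamily A Θ Ξ) (θ : Θ) {h : ℕ} (τ : History A h) :
    alg.weight θ τ = BayesBandit.weight alg.seed (alg.act θ) τ := rfl

theorem AlgFamily.weight_le_one (alg : AlgFamily A Θ Ξ) (θ : Θ) {h : ℕ} (τ : History A h) :
    alg.weight θ τ ≤ 1 := by
  rw [alg.weight_eq]
  calc _ ≤ ∫⁻ _, 1 ∂alg.seed := lintegral_mono fun ξ => likelihood_le_one _ τ ξ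
    _ = 1 := by simp

variable [Countable A] [DiscreteMeasurableSpace A]

theorem AlgFamily.measurable_seedWeight (alg : AlgFamily A Θ Ξ) (θ : Θ) {h : ℕ}
    (τ : History A h) : Measurable (alg.seedWeight θ τ) :=
  (measurable_likelihood (alg.act θ) h).comp measurable_prodMk_left

theorem AlgFamily.measurable_weight (alg : AlgFamily A Θ Ξ) (θ : Θ) (h : ℕ) :
    Measurable (fun τ : History A h => alg.weight θ τ) :=
  BayesBandit.measurable_weight alg.seed (alg.act θ) h

theorem AlgFamily.lintegral_law (I : Instance A Θ) (alg : AlgFamily A Θ Ξ) (θ θ₁ : Θ) (h : ℕ)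
    {g : (A → ℝ) × History A h → ℝ≥0∞} (hg : Measurable g) :
    ∫⁻ x, g x ∂(I.law alg θ θ₁ h) =
      ∫⁻ x, alg.weight θ₁ x.2 * g x ∂(baseLaw (I.prior θ) I.reward h) :=
  lintegral_jointLaw _ _ _ _ h hg

instance (I : Instance A Θ) (alg : AlgFamily A Θ Ξ) (θ θ₁ : Θ) (h : ℕ) :
    IsProbabilityMeasure (I.law alg θ θ₁ h) := by
  unfold Instance.law; infer_instance

theorem AlgFamily.lintegral_weight (I : Instance A Θ) (alg : AlgFamily A Θ Ξ) (θ θ₁ : Θ) (h : ℕ) :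
    ∫⁻ x, alg.weight θ₁ x.2 ∂(baseLaw (I.prior θ) I.reward h) = 1 := by
  have := alg.lintegral_law I θ θ₁ h (g := fun _ => 1) measurable_const
  simpa using this.symm

theorem AlgFamily.actionLaw_apply (alg : AlgFamily A Θ Ξ) (θ : Θ) {h : ℕ} (τ : History A h)
    {s : Set A} (hs : MeasurableSet s) :
    alg.actionLaw θ τ s =
      (alg.weight θ τ)⁻¹ * ∫⁻ ξ, alg.seedWeight θ τ ξ * alg.act θ h (τ, ξ) s ∂alg.seed := by
  have h1 : Measurable (fun ξ => alg.act θ h (τ, ξ)) :=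
    (alg.act θ h).measurable.comp measurable_prodMk_left
  have h2 : Measurable (fun ξ => alg.act θ h (τ, ξ) s) := Measure.measurable_coe hs |>.comp h1
  rw [AlgFamily.actionLaw, Measure.bind_apply hs h1.aemeasurable, AlgFamily.seedPosterior,
    lintegral_smul_measure, lintegral_withDensity_eq_lintegral_mul _
      (alg.measurable_seedWeight θ τ) h2]
  rfl

theorem AlgFamily.isProbabilityMeasure_actionLaw (alg : AlgFamily A Θ Ξ) (θ : Θ) {h : ℕ}
    {τ : History A h} (hτ : alg.weight θ τ ≠ 0) : IsProbabilityMeasure (alg.actionLaw θ τ) := by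
  constructor
  rw [alg.actionLaw_apply θ τ MeasurableSet.univ]
  simp only [measure_univ, mul_one]
  exact ENNReal.inv_mul_cancel hτ ((alg.weight_le_one θ τ).trans_lt ENNReal.one_lt_top).ne

/-- The likelihood factors through the conditional law of the next action. -/
theorem AlgFamily.weight_snoc (alg : AlgFamily A Θ Ξ) (θ : Θ) {h : ℕ}
    {τ : History A h} (hτ : alg.weight θ τ ≠ 0) (y : A × ℝ) :
    alg.weight θ (Fin.snoc τ y : History A (h + 1)) =
      alg.weight θ τ * alg.actionLaw θ τ {y.1} := by
  rw [alg.actionLaw_apply θ τ (MeasurableSet.singleton _), ← mul_assoc, ENNReal.mul_inv_cancel hτ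
    ((alg.weight_le_one θ τ).trans_lt ENNReal.one_lt_top).ne, one_mul]
  exact lintegral_congr fun ξ => likelihood_snoc (alg.act θ) τ y ξ

end Weights

/-! ### Common mass of the trajectory laws of two policies -/

section Overlap
variable {A Θ Ξ : Type*} [MeasurableSpace A] [MeasurableSpace Ξ] [Countable A]

theorem lintegral_baseLaw_eq (P : Measure (A → ℝ)) [IsProbabilityMeasure P]
    (D : Kernel (A → ℝ) (A → ℝ)) [IsMarkovKernel D] (h : ℕ)
    {g : (A → ℝ) × History A h → ℝ≥0∞} (hg : Measurable g) :
    ∫⁻ x, g x ∂(baseLaw P D h) = ∫⁻ μ, ∫⁻ τ, g (μ, τ) ∂(baseTraj D h μ) ∂P :=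
  Measure.lintegral_compProd hg

theorem lintegral_baseLaw_succ (P : Measure (A → ℝ)) [IsProbabilityMeasure P]
    (D : Kernel (A → ℝ) (A → ℝ)) [IsMarkovKernel D] (h : ℕ)
    {g : History A (h + 1) → ℝ≥0∞} (hg : Measurable g) :
    ∫⁻ x, g x.2 ∂(baseLaw P D (h + 1)) =
      ∫⁻ x, ∑' a, ∫⁻ r, g (Fin.snoc x.2 (a, r a)) ∂(D x.1) ∂(baseLaw P D h) := by
  have hG : Measurable fun x : (A → ℝ) × History A h =>
      ∑' a, ∫⁻ r, g (Fin.snoc x.2 (a, r a)) ∂(D x.1) := by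
    refine Measurable.tsum fun a => ?_
    have : Measurable fun z : ((A → ℝ) × History A h) × (A → ℝ) =>
        g (Fin.snoc z.1.2 (a, z.2 a)) := by
      have h1 : Measurable fun z : ((A → ℝ) × History A h) × (A → ℝ) =>
          (z.1.2, ((a, z.2 a) : A × ℝ)) :=
        (measurable_snd.comp measurable_fst).prodMk
          ((measurable_reward a).comp measurable_snd)
      exact hg.comp ((measurable_snoc h).comp h1)
    exact this.lintegral_kernel_prod_right' (κ := D.comap Prod.fst measurable_fst)
  have hg' : Measurable fun x : (A → ℝ) × History A (h + 1) => g x.2 := hg.comp measurable_snd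
  rw [lintegral_baseLaw_eq P D h hG, lintegral_baseLaw_eq P D (h + 1) hg']
  exact lintegral_congr fun μ => lintegral_baseTraj_succ D μ h hg

variable [DiscreteMeasurableSpace A]

/-- Playing the same policy under two priors: expectations of `[0, 1]`-valued functions of the mean
vector and the trajectory differ by at most the distance of the priors. -/
theorem AlgFamily.lintegral_weight_mul_le (I : Instance A Θ) (alg : AlgFamily A Θ Ξ)
    (θ θ' θ₁ : Θ) (h : ℕ) {g : (A → ℝ) × History A h → ℝ≥0∞} (hg : Measurable g)
    (hg1 : ∀ x, g x ≤ 1) :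
    ∫⁻ x, alg.weight θ₁ x.2 * g x ∂(baseLaw (I.prior θ) I.reward h) ≤
      ∫⁻ x, alg.weight θ₁ x.2 * g x ∂(baseLaw (I.prior θ') I.reward h) +
        ENNReal.ofReal (tv (I.prior θ) (I.prior θ')) := by
  have hW : Measurable fun x : (A → ℝ) × History A h => alg.weight θ₁ x.2 :=
    (alg.measurable_weight θ₁ h).comp measurable_snd
  have hWg := hW.mul hg
  -- The density has total mass one for each mean vector: take a point mass as the prior.
  have hone : ∀ μ : A → ℝ, ∫⁻ τ, alg.weight θ₁ τ ∂(baseTraj I.reward h μ) = 1 := by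
    intro μ
    have h1 := lintegral_jointLaw (Measure.dirac μ) I.reward alg.seed (alg.act θ₁) h
      (g := fun _ => 1) measurable_const
    simp only [mul_one] at h1
    change _ = ∫⁻ x : (A → ℝ) × History A h, alg.weight θ₁ x.2 ∂_ at h1
    rw [lintegral_baseLaw_eq _ _ _ hW, lintegral_dirac' _ hW.lintegral_kernel_prod_right'] at h1
    simpa using h1.symm
  simp only [Pi.mul_def] at hWg
  rw [lintegral_baseLaw_eq _ _ _ hWg, lintegral_baseLaw_eq _ _ _ hWg]
  refine lintegral_le_add_tv _ _ hWg.lintegral_kernel_prod_right' fun μ => ?_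
  rw [← hone μ]
  exact lintegral_mono fun τ => mul_le_of_le_one_right' (hg1 _)

/-- On average over the trajectories of a policy, the posteriors are at most twice as far apart
as the priors. The distance of the posteriors is written through measurable Hahn sets `S`. With
`m`, `m'` the trajectory laws under the two priors and `p`, `p'` the posteriors, `p m` and `p'
m'` are at distance at most `ε`, and so are `p' m'` and `p' m`. -/
theorem AlgFamily.lintegral_weight_mul_posterior_sub_le (I : Instance A Θ)
    (alg : AlgFamily A Θ Ξ) {post : Θ → (h : ℕ) → Kernel (History A h) (A → ℝ)}
    (hpost : ∀ θ, IsPosterior (I.prior θ) I.reward (post θ)) (θ θ' θ₁ : Θ) (h : ℕ)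
    {S : Set (History A h × (A → ℝ))} (hS : MeasurableSet S)
    (hle : ∀ τ, post θ' h τ (Prod.mk τ ⁻¹' S) ≤ post θ h τ (Prod.mk τ ⁻¹' S)) :
    ∫⁻ x, alg.weight θ₁ x.2 * (post θ h x.2 (Prod.mk x.2 ⁻¹' S) -
        post θ' h x.2 (Prod.mk x.2 ⁻¹' S)) ∂(baseLaw (I.prior θ) I.reward h) ≤
      2 * ENNReal.ofReal (tv (I.prior θ) (I.prior θ')) := by
  have : Nonempty A := alg.nonempty_action θ
  have hmk (η : Θ) (k : ℕ) : IsMarkovKernel (post η k) := (hpost η).1 k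
  have hW : Measurable fun x : (A → ℝ) × History A h => alg.weight θ₁ x.2 :=
    (alg.measurable_weight θ₁ h).comp measurable_snd
  have hp (η : Θ) : Measurable fun x : (A → ℝ) × History A h =>
      post η h x.2 (Prod.mk x.2 ⁻¹' S) :=
    (Kernel.measurable_kernel_prodMk_left (κ := post η h) hS).comp measurable_snd
  let g : (A → ℝ) × History A h → ℝ≥0∞ := fun x => S.indicator 1 (x.2, x.1)
  have hg : Measurable g := (measurable_one.indicator hS).comp measurable_swap
  have hg1 (x) : g x ≤ 1 := by
    dsimp only [g]
    exact Set.indicator_le_self' (f := (1 : History A h × (A → ℝ) → ℝ≥0∞)) (by simp) _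
  have hcond (η : Θ) : ∫⁻ x, alg.weight θ₁ x.2 * g x ∂(baseLaw (I.prior η) I.reward h) =
      ∫⁻ x, alg.weight θ₁ x.2 * post η h x.2 (Prod.mk x.2 ⁻¹' S)
        ∂(baseLaw (I.prior η) I.reward h) := by
    have hWg : Measurable fun x => alg.weight θ₁ x.2 * g x := hW.mul hg
    rw [(hpost η).lintegral_baseLaw h hWg]
    refine lintegral_congr fun x => ?_
    dsimp only
    have hgx : Measurable fun μ => g (μ, x.2) := hg.comp measurable_prodMk_right
    rw [lintegral_const_mul _ hgx]
    congr 1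
    exact lintegral_indicator_one (measurable_prodMk_left hS)
  have hfin : ∫⁻ x, alg.weight θ₁ x.2 * post θ' h x.2 (Prod.mk x.2 ⁻¹' S)
      ∂(baseLaw (I.prior θ) I.reward h) ≠ ∞ := by
    refine (lt_of_le_of_lt ?_ ENNReal.one_lt_top).ne
    rw [← alg.lintegral_weight I θ θ₁ h]
    exact lintegral_mono fun x => mul_le_of_le_one_right' prob_le_one
  -- Add `p' m (S)` to both sides, so that the left side becomes `p m (S)`.
  refine (ENNReal.add_le_add_iff_right hfin).1 ?_
  have hWp : Measurable fun x : (A → ℝ) × History A h =>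
      alg.weight θ₁ x.2 * post θ' h x.2 (Prod.mk x.2 ⁻¹' S) := hW.mul (hp θ')
  rw [← lintegral_add_right _ hWp]
  simp_rw [← mul_add, tsub_add_cancel_of_le (hle _)]
  calc _ = ∫⁻ x, alg.weight θ₁ x.2 * g x ∂(baseLaw (I.prior θ) I.reward h) := (hcond θ).symm
    _ ≤ _ := alg.lintegral_weight_mul_le I θ θ' θ₁ h hg hg1
    _ ≤ ∫⁻ x, alg.weight θ₁ x.2 * post θ' h x.2 (Prod.mk x.2 ⁻¹' S)
          ∂(baseLaw (I.prior θ) I.reward h) + ENNReal.ofReal (tv (I.prior θ') (I.prior θ)) +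
          ENNReal.ofReal (tv (I.prior θ) (I.prior θ')) := by
      rw [hcond θ']
      gcongr
      exact alg.lintegral_weight_mul_le I θ' θ θ₁ h (hp θ') fun _ => prob_le_one
    _ = _ := by rw [tv_comm (I.prior θ')]; ring

/-- Mass that the laws of the trajectories of two policies have in common, under the prior `P_θ`. -/
noncomputable def AlgFamily.overlap (I : Instance A Θ) (alg : AlgFamily A Θ Ξ) (θ θ₁ θ₂ : Θ)
    (h : ℕ) : ℝ≥0∞ :=
  ∫⁻ x, min (alg.weight θ₁ x.2) (alg.weight θ₂ x.2) ∂(baseLaw (I.prior θ) I.reward h)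

/-- One step of a Monte Carlo family destroys at most `2nε` of the common mass. As only the common
mass is followed, the Monte Carlo inequality is needed only where both likelihoods are positive. -/
theorem AlgFamily.overlap_le_succ (I : Instance A Θ)
    (alg : AlgFamily A Θ Ξ) {post : Θ → (h : ℕ) → Kernel (History A h) (A → ℝ)}
    (hpost : ∀ θ, IsPosterior (I.prior θ) I.reward (post θ)) {H : ℕ} {n : ℝ} (hn : 0 < n)
    (hMC : alg.IsMonteCarlo post H n) (θ θ' : Θ) {h : ℕ} (hh : h < H) :
    alg.overlap I θ θ θ' h ≤ alg.overlap I θ θ θ' (h + 1) +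
      ENNReal.ofReal n * (2 * ENNReal.ofReal (tv (I.prior θ) (I.prior θ'))) := by
  have hmk (η : Θ) (k : ℕ) : IsMarkovKernel (post η k) := (hpost η).1 k
  obtain ⟨S, hS, hS'⟩ := exists_measurable_hahn (post θ h) (post θ' h)
  let T : (A → ℝ) × History A h → ℝ≥0∞ := fun x => alg.weight θ x.2 *
    (post θ h x.2 (Prod.mk x.2 ⁻¹' S) - post θ' h x.2 (Prod.mk x.2 ⁻¹' S))
  have hp (η : Θ) : Measurable fun x : (A → ℝ) × History A h =>
      post η h x.2 (Prod.mk x.2 ⁻¹' S) :=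
    (Kernel.measurable_kernel_prodMk_left (κ := post η h) hS).comp measurable_snd
  have hT : Measurable T :=
    ((alg.measurable_weight θ h).comp measurable_snd).mul ((hp θ).sub (hp θ'))
  have hTle := alg.lintegral_weight_mul_posterior_sub_le I hpost θ θ' θ h hS fun τ => (hS' τ).1
  have hmin : Measurable fun τ : History A (h + 1) => min (alg.weight θ τ) (alg.weight θ' τ) :=
    (alg.measurable_weight θ _).min (alg.measurable_weight θ' _)
  have hpt : ∀ x : (A → ℝ) × History A h, min (alg.weight θ x.2) (alg.weight θ' x.2) ≤
      ∑' a, ∫⁻ r, min (alg.weight θ (Fin.snoc x.2 (a, r a) : History A (h + 1)))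
        (alg.weight θ' (Fin.snoc x.2 (a, r a) : History A (h + 1))) ∂(I.reward x.1) +
      ENNReal.ofReal n * T x := by
    rintro ⟨μ, τ⟩
    dsimp only [T]
    by_cases h1 : alg.weight θ τ = 0
    · simp [h1]
    by_cases h2 : alg.weight θ' τ = 0
    · simp [h2]
    have := alg.isProbabilityMeasure_actionLaw θ h1
    have := alg.isProbabilityMeasure_actionLaw θ' h2
    simp_rw [alg.weight_snoc θ h1, alg.weight_snoc θ' h2]
    simp only [lintegral_const, measure_univ, mul_one]
    set w := alg.weight θ τ
    set w' := alg.weight θ' τ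
    have htv : ENNReal.ofReal (tv (alg.actionLaw θ τ) (alg.actionLaw θ' τ)) ≤
        ENNReal.ofReal n * (post θ h τ (Prod.mk τ ⁻¹' S) - post θ' h τ (Prod.mk τ ⁻¹' S)) := by
      refine (ENNReal.ofReal_le_ofReal (hMC θ θ' h hh τ h1 h2)).trans ?_
      rw [ENNReal.ofReal_mul hn.le]
      gcongr
      exact (hS' τ).2
    calc min w w' = min w w' * 1 := (mul_one _).symm
      _ ≤ min w w' * (∑' a, min (alg.actionLaw θ τ {a}) (alg.actionLaw θ' τ {a}) +
          ENNReal.ofReal (tv (alg.actionLaw θ τ) (alg.actionLaw θ' τ))) := by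
        gcongr
        exact one_le_tsum_min_add_tv _ _
      _ ≤ _ := by
        rw [mul_add, ← ENNReal.tsum_mul_left]
        refine add_le_add (ENNReal.tsum_le_tsum fun a => ?_) ?_
        · exact le_min (by gcongr <;> exact min_le_left _ _) (by gcongr <;> exact min_le_right _ _)
        · exact mul_le_mul' (min_le_left _ _) htv |>.trans_eq (mul_left_comm _ _ _)
  unfold AlgFamily.overlap
  calc _ ≤ _ := lintegral_mono hpt
    _ = _ := lintegral_add_right _ (hT.const_mul _)
    _ ≤ _ := by
      rw [← lintegral_baseLaw_succ (I.prior θ) I.reward h hmin, lintegral_const_mul _ hT]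
      gcongr

theorem AlgFamily.one_le_overlap_add (I : Instance A Θ)
    (alg : AlgFamily A Θ Ξ) {post : Θ → (h : ℕ) → Kernel (History A h) (A → ℝ)}
    (hpost : ∀ θ, IsPosterior (I.prior θ) I.reward (post θ)) {H : ℕ} {n : ℝ} (hn : 0 < n)
    (hMC : alg.IsMonteCarlo post H n) (θ θ' : Θ) {h : ℕ} (hh : h ≤ H) :
    1 ≤ alg.overlap I θ θ θ' h +
      ENNReal.ofReal (2 * n * h * tv (I.prior θ) (I.prior θ')) := by
  induction h with
  | zero =>
    have : ∀ (η : Θ) (τ : History A 0), alg.weight η τ = 1 := by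
      intro η τ
      simp [AlgFamily.weight, AlgFamily.seedWeight]
    have h1 := alg.lintegral_weight I θ θ 0
    simp only [AlgFamily.overlap, this, min_self] at h1 ⊢
    rw [h1]
    exact le_self_add
  | succ h ih =>
    refine (ih (by omega)).trans ?_
    have h1 := alg.overlap_le_succ I hpost hn hMC θ θ' (h := h) (by omega)
    refine (add_le_add_left h1 _).trans_eq ?_
    have ht := tv_nonneg (I.prior θ) (I.prior θ')
    rw [add_assoc]
    congr 1
    rw [← ENNReal.ofReal_ofNat, ← ENNReal.ofReal_mul (by norm_num), ← ENNReal.ofReal_mul hn.le,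
      ← ENNReal.ofReal_add (by positivity) (by positivity)]
    congr 1
    push_cast
    ring

/-- The part of either trajectory law that exceeds the other one is the complement of the common
mass. -/
theorem AlgFamily.lintegral_weight_sub_le (I : Instance A Θ) (alg : AlgFamily A Θ Ξ)
    (θ θ₁ θ₂ : Θ) (h : ℕ) {c : ℝ≥0∞} (hc : 1 ≤ alg.overlap I θ θ₁ θ₂ h + c) :
    ∫⁻ x, (alg.weight θ₁ x.2 - alg.weight θ₂ x.2) ∂(baseLaw (I.prior θ) I.reward h) ≤ c := by
  have hm : Measurable fun x : (A → ℝ) × History A h =>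
      min (alg.weight θ₁ x.2) (alg.weight θ₂ x.2) :=
    ((alg.measurable_weight θ₁ h).min (alg.measurable_weight θ₂ h)).comp measurable_snd
  have h1 := alg.lintegral_weight I θ θ₁ h
  have hfin : alg.overlap I θ θ₁ θ₂ h ≠ ∞ := by
    refine (lt_of_le_of_lt ?_ ENNReal.one_lt_top).ne
    rw [← h1]
    exact lintegral_mono fun x => min_le_left _ _
  refine (ENNReal.add_le_add_iff_right hfin).1 ?_
  rw [add_comm c]
  refine le_trans (le_of_eq ?_) hc
  rw [← h1, AlgFamily.overlap, ← lintegral_add_right _ hm]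
  refine lintegral_congr fun x => ?_
  rcases le_total (alg.weight θ₁ x.2) (alg.weight θ₂ x.2) with h | h
  · rw [min_eq_left h, tsub_eq_zero_of_le h, zero_add]
  · rw [min_eq_right h, tsub_add_cancel_of_le h]

end Overlap

/-! ### Rewards and means -/

theorem measurable_extend {A Ξ : Type*} [MeasurableSpace A] [MeasurableSpace Ξ] (h : ℕ) :
    Measurable (fun z : (((A → ℝ) × Ξ) × History A h) × (A × ℝ) =>
      (z.1.1.1, (Fin.snoc z.1.2 z.2 : History A (h + 1)))) := by
  have h1 : Measurable fun z : (((A → ℝ) × Ξ) × History A h) × (A × ℝ) => (z.1.2, z.2) := by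
    fun_prop
  have h2 : Measurable fun z : (((A → ℝ) × Ξ) × History A h) × (A × ℝ) => z.1.1.1 := by fun_prop
  exact h2.prodMk ((measurable_snoc h).comp h1)

section Rewards
variable {A Ξ : Type*} [MeasurableSpace A] [MeasurableSpace Ξ] [Countable A]
  [DiscreteMeasurableSpace A]
  (P : Measure (A → ℝ)) [IsProbabilityMeasure P] (D : Kernel (A → ℝ) (A → ℝ)) [IsMarkovKernel D]
  (seed : Measure Ξ) [IsProbabilityMeasure seed]
  (f : (h : ℕ) → Kernel (History A h × Ξ) A) [∀ h, IsMarkovKernel (f h)]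

theorem measurable_eval_pair : Measurable (fun x : A × (A → ℝ) => x.2 x.1) :=
  measurable_snd.comp measurable_record

/-- The law of `h + 1` steps is obtained by drawing one more step. -/
theorem jointLaw_succ (h : ℕ) :
    jointLaw P D seed f (h + 1) =
      (((P.prod seed) ⊗ₘ trajKernel D f h) ⊗ₘ stepKernel D (f h)).map
        (fun z : (((A → ℝ) × Ξ) × History A h) × (A × ℝ) =>
          (z.1.1.1, (Fin.snoc z.1.2 z.2 : History A (h + 1)))) := by
  refine Measure.ext_of_lintegral _ fun g hg => ?_
  have hm : Measurable (fun x : ((A → ℝ) × Ξ) × History A (h + 1) => (x.1.1, x.2)) := by fun_prop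
  have hgm : Measurable (fun x : ((A → ℝ) × Ξ) × History A (h + 1) => g (x.1.1, x.2)) :=
    hg.comp hm
  have hge : Measurable (fun z : (((A → ℝ) × Ξ) × History A h) × (A × ℝ) =>
      g (z.1.1.1, (Fin.snoc z.1.2 z.2 : History A (h + 1)))) := hg.comp (measurable_extend h)
  rw [jointLaw, lintegral_map hg hm, Measure.lintegral_compProd hgm,
    lintegral_map hg (measurable_extend h), Measure.lintegral_compProd hge,
    Measure.lintegral_compProd hge.lintegral_kernel_prod_right']
  refine lintegral_congr fun x => ?_
  have hgx : Measurable fun τ : History A (h + 1) => g (x.1, τ) := hg.comp measurable_prodMk_left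
  have hgs : Measurable fun y : History A h × (A × ℝ) =>
      g (x.1, (Fin.snoc y.1 y.2 : History A (h + 1))) := hgx.comp (measurable_snoc h)
  dsimp only
  rw [trajKernel, Kernel.lintegral_map _ (measurable_snoc h) _ hgx,
    Kernel.lintegral_compProd _ _ _ hgs]

/-- Forgetting the last step. -/
theorem map_castSucc_jointLaw (h : ℕ) :
    (jointLaw P D seed f (h + 1)).map
        (fun x => (x.1, fun i : Fin h => x.2 i.castSucc)) = jointLaw P D seed f h := by
  have hm : Measurable (fun x : (A → ℝ) × History A (h + 1) =>
      (x.1, (fun i : Fin h => x.2 i.castSucc : History A h))) := by fun_prop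
  rw [jointLaw_succ, Measure.map_map hm (measurable_extend h)]
  have : (fun x : (A → ℝ) × History A (h + 1) =>
      (x.1, (fun i : Fin h => x.2 i.castSucc : History A h))) ∘
      (fun z : (((A → ℝ) × Ξ) × History A h) × (A × ℝ) =>
        (z.1.1.1, (Fin.snoc z.1.2 z.2 : History A (h + 1)))) =
      (fun x : ((A → ℝ) × Ξ) × History A h => (x.1.1, x.2)) ∘ Prod.fst := by
    funext z
    simp
  rw [this, ← Measure.map_map (by fun_prop) measurable_fst]
  change Measure.map _ (Measure.fst _) = _
  rw [Measure.fst_compProd]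
  rfl

theorem map_fst_jointLaw (h : ℕ) : (jointLaw P D seed f h).map Prod.fst = P := by
  rw [jointLaw, Measure.map_map measurable_fst (by fun_prop)]
  have : Prod.fst ∘ (fun x : ((A → ℝ) × Ξ) × History A h => (x.1.1, x.2)) =
      Prod.fst ∘ Prod.fst := rfl
  rw [this, ← Measure.map_map measurable_fst measurable_fst]
  change Measure.fst (Measure.fst _) = _
  rw [Measure.fst_compProd, Measure.fst_prod]

theorem lintegral_enorm_mean_le (hD : ∀ (μ : A → ℝ) (a : A), ∫ r, r a ∂(D μ) = μ a) {h : ℕ}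
    (x : ((A → ℝ) × Ξ) × History A h) :
    ∫⁻ y, ‖x.1.1 y.1‖ₑ ∂(stepKernel D (f h) x) ≤ ∫⁻ y, ‖y.2‖ₑ ∂(stepKernel D (f h) x) := by
  obtain ⟨⟨μ, ξ⟩, τ⟩ := x
  have hμ : Measurable fun y : A × ℝ => ‖μ y.1‖ₑ :=
    ((Measurable.of_discrete (f := μ)).comp measurable_fst).enorm
  have h2 : Measurable fun y : A × ℝ => ‖y.2‖ₑ := measurable_snd.enorm
  rw [lintegral_stepKernel D (f h) μ ξ τ hμ, lintegral_stepKernel D (f h) μ ξ τ h2]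
  refine ENNReal.tsum_le_tsum fun a => ?_
  refine mul_le_mul_left ?_ _
  dsimp only
  rw [lintegral_const, measure_univ, mul_one]
  conv_lhs => rw [← hD μ a]
  exact enorm_integral_le_lintegral_enorm fun r : A → ℝ => r a

/-- The expected reward of one step is the mean of the action that is played. -/
theorem integral_stepKernel (hD : ∀ (μ : A → ℝ) (a : A), ∫ r, r a ∂(D μ) = μ a) {h : ℕ}
    (x : ((A → ℝ) × Ξ) × History A h)
    (hint : Integrable (fun y : A × ℝ => y.2) (stepKernel D (f h) x))
    (hint' : Integrable (fun y : A × ℝ => x.1.1 y.1) (stepKernel D (f h) x)) :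
    ∫ y, y.2 ∂(stepKernel D (f h) x) = ∫ y, x.1.1 y.1 ∂(stepKernel D (f h) x) := by
  have hμ : Measurable fun y : A × ℝ => x.1.1 y.1 :=
    (Measurable.of_discrete (f := x.1.1)).comp measurable_fst
  have hrec := measurable_record (A := A)
  rw [stepKernel, Kernel.map_apply _ hrec, Kernel.prod_apply] at hint hint' ⊢
  rw [integral_map hrec.aemeasurable measurable_snd.aestronglyMeasurable,
    integral_map hrec.aemeasurable hμ.aestronglyMeasurable]
  have i1 := (integrable_map_measure measurable_snd.aestronglyMeasurable hrec.aemeasurable).1 hint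
  have i2 := (integrable_map_measure hμ.aestronglyMeasurable hrec.aemeasurable).1 hint'
  refine (integral_prod _ i1).trans (Eq.trans ?_ (integral_prod _ i2).symm)
  refine integral_congr_ae (Filter.Eventually.of_forall fun a => ?_)
  simp only [Function.comp_apply, integral_const, probReal_univ, one_smul]
  exact hD _ a

/-- An integrable reward can be replaced by the mean of the action that earned it. -/
theorem integral_reward_eq (hD : ∀ (μ : A → ℝ) (a : A), ∫ r, r a ∂(D μ) = μ a) {H : ℕ} (h : Fin H)
    (hint : Integrable (fun x : (A → ℝ) × History A H => (x.2 h).2) (jointLaw P D seed f H)) :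
    Integrable (fun x : (A → ℝ) × History A H => x.1 (x.2 h).1) (jointLaw P D seed f H) ∧
      ∫ x, (x.2 h).2 ∂(jointLaw P D seed f H) = ∫ x, x.1 (x.2 h).1 ∂(jointLaw P D seed f H) := by
  have hr : ∀ {H : ℕ} (h : Fin H), Measurable (fun x : (A → ℝ) × History A H => (x.2 h).2) :=
    fun h => by fun_prop
  have hμ : ∀ {H : ℕ} (h : Fin H),
      Measurable (fun x : (A → ℝ) × History A H => x.1 (x.2 h).1) := fun h => by
    have h1 : Measurable (fun x : (A → ℝ) × History A _ => ((x.2 h).1, x.1)) := by fun_prop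
    exact measurable_eval_pair.comp h1
  induction H with
  | zero => exact h.elim0
  | succ H ih =>
    cases h using Fin.lastCases with
    | last =>
      have hm := measurable_extend (A := A) (Ξ := Ξ) H
      rw [jointLaw_succ] at hint ⊢
      rw [integral_map hm.aemeasurable (hr _).aestronglyMeasurable,
        integral_map hm.aemeasurable (hμ _).aestronglyMeasurable]
      rw [integrable_map_measure (hr _).aestronglyMeasurable hm.aemeasurable] at hint
      rw [integrable_map_measure (hμ _).aestronglyMeasurable hm.aemeasurable]
      simp only [Function.comp_def, Fin.snoc_last] at hint ⊢
      have hμ' : Measurable (fun z : (((A → ℝ) × Ξ) × History A H) × (A × ℝ) =>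
          z.1.1.1 z.2.1) := by
        have h1 : Measurable (fun z : (((A → ℝ) × Ξ) × History A H) × (A × ℝ) =>
          (z.2.1, z.1.1.1)) := by fun_prop
        exact measurable_eval_pair.comp h1
      have hint' : Integrable (fun z : (((A → ℝ) × Ξ) × History A H) × (A × ℝ) =>
          z.1.1.1 z.2.1) (((P.prod seed) ⊗ₘ trajKernel D f H) ⊗ₘ stepKernel D (f H)) := by
        refine ⟨hμ'.aestronglyMeasurable, lt_of_le_of_lt ?_ hint.2⟩
        have hr' : Measurable (fun z : (((A → ℝ) × Ξ) × History A H) × (A × ℝ) => ‖z.2.2‖ₑ) := by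
          fun_prop
        rw [Measure.lintegral_compProd hμ'.enorm, Measure.lintegral_compProd hr']
        exact lintegral_mono fun x => lintegral_enorm_mean_le D f hD x
      refine ⟨hint', ?_⟩
      rw [Measure.integral_compProd hint, Measure.integral_compProd hint']
      refine integral_congr_ae ?_
      filter_upwards [((Measure.integrable_compProd_iff hint.1).1 hint).1,
        ((Measure.integrable_compProd_iff hint'.1).1 hint').1] with x h1 h2
      exact integral_stepKernel D f hD x h1 h2
    | cast h =>
      have hm : Measurable (fun x : (A → ℝ) × History A (H + 1) =>
        (x.1, (fun i : Fin H => x.2 i.castSucc : History A H))) := by fun_prop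
      have ih' := ih h
      rw [← map_castSucc_jointLaw P D seed f H,
        integral_map hm.aemeasurable (hr _).aestronglyMeasurable,
        integral_map hm.aemeasurable (hμ _).aestronglyMeasurable,
        integrable_map_measure (hr _).aestronglyMeasurable hm.aemeasurable,
        integrable_map_measure (hμ _).aestronglyMeasurable hm.aemeasurable] at ih'
      exact ih' hint

end Rewards

/-! ### Difference of the expected rewards -/

section Comparison
variable {A Θ Ξ : Type*} [MeasurableSpace A] [MeasurableSpace Ξ] [Countable A]
  [DiscreteMeasurableSpace A]

theorem Instance.map_fst_law (I : Instance A Θ) (alg : AlgFamily A Θ Ξ) (θ θ₁ : Θ) (H : ℕ) :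
    (I.law alg θ θ₁ H).map Prod.fst = I.prior θ :=
  map_fst_jointLaw _ _ _ _ _

theorem Instance.lintegral_fst_law (I : Instance A Θ) (alg : AlgFamily A Θ Ξ) (θ θ₁ : Θ) (H : ℕ)
    {g : (A → ℝ) → ℝ≥0∞} (hg : Measurable g) :
    ∫⁻ x, g x.1 ∂(I.law alg θ θ₁ H) = ∫⁻ μ, g μ ∂(I.prior θ) := by
  rw [← I.map_fst_law alg θ θ₁ H, lintegral_map hg measurable_fst]

/-- Expected means of the action played at step `h` under two policies. Subtracting a function `m`
of the mean vector, whose expectation is the same under both, leaves a nonnegative integrand, which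
is integrated against the excess of one trajectory law over the other. -/
theorem integral_mean_le (I : Instance A Θ) (alg : AlgFamily A Θ Ξ) (θ θ₁ θ₂ : Θ) {H : ℕ}
    (h : Fin H)
    (h1 : Integrable (fun x : (A → ℝ) × History A H => x.1 (x.2 h).1) (I.law alg θ θ₁ H))
    (h2 : Integrable (fun x : (A → ℝ) × History A H => x.1 (x.2 h).1) (I.law alg θ θ₂ H))
    {m : (A → ℝ) → ℝ} (hm : Measurable m) {d : (A → ℝ) → ℝ≥0∞} (hd : Measurable d)
    (hdint : ∫⁻ μ, d μ ∂(I.prior θ) ≠ ∞)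
    (hmd : ∀ᵐ μ ∂(I.prior θ), ∀ a, m μ ≤ μ a ∧ ENNReal.ofReal (μ a - m μ) ≤ d μ)
    {C : ℝ} (hC0 : 0 ≤ C)
    (hC : ∫⁻ x, d x.1 * (alg.weight θ₁ x.2 - alg.weight θ₂ x.2)
      ∂(baseLaw (I.prior θ) I.reward H) ≤ ENNReal.ofReal C) :
    ∫ x, x.1 (x.2 h).1 ∂(I.law alg θ θ₁ H) ≤ ∫ x, x.1 (x.2 h).1 ∂(I.law alg θ θ₂ H) + C := by
  let F : (A → ℝ) × History A H → ℝ := fun x => x.1 (x.2 h).1 - m x.1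
  have hF : Measurable F := by
    have hp : Measurable (fun x : (A → ℝ) × History A H => ((x.2 h).1, x.1)) := by fun_prop
    exact (measurable_eval_pair.comp hp).sub (hm.comp measurable_fst)
  have hae : ∀ η, ∀ᵐ x ∂(I.law alg θ η H), 0 ≤ F x ∧ ENNReal.ofReal (F x) ≤ d x.1 := by
    intro η
    rw [← I.map_fst_law alg θ η H] at hmd
    filter_upwards [ae_of_ae_map measurable_fst.aemeasurable hmd] with x hx
    exact ⟨sub_nonneg.2 (hx _).1, (hx _).2⟩
  have hFfin : ∀ η, ∫⁻ x, ENNReal.ofReal (F x) ∂(I.law alg θ η H) ≠ ∞ := by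
    intro η
    refine (lt_of_le_of_lt ?_ hdint.lt_top).ne
    rw [← I.lintegral_fst_law alg θ η H hd]
    exact lintegral_mono_ae ((hae η).mono fun x hx => hx.2)
  have hFint : ∀ η, Integrable F (I.law alg θ η H) := fun η =>
    (lintegral_ofReal_ne_top_iff_integrable hF.aestronglyMeasurable
      ((hae η).mono fun x hx => hx.1)).1 (hFfin η)
  have hval : ∀ η, Integrable (fun x : (A → ℝ) × History A H => x.1 (x.2 h).1)
      (I.law alg θ η H) → ∫ x, x.1 (x.2 h).1 ∂(I.law alg θ η H) =
        ∫ x, F x ∂(I.law alg θ η H) + ∫ μ, m μ ∂(I.prior θ) := by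
    intro η hη
    rw [← I.map_fst_law alg θ η H, integral_map measurable_fst.aemeasurable
      hm.aestronglyMeasurable]
    have hmint : Integrable (fun x : (A → ℝ) × History A H => m x.1) (I.law alg θ η H) := by
      refine (hη.sub (hFint η)).congr (Filter.Eventually.of_forall fun x => ?_)
      simp [F]
    rw [← integral_add (hFint η) hmint]
    simp [F]
  rw [hval θ₁ h1, hval θ₂ h2, add_right_comm]
  gcongr
  rw [integral_eq_lintegral_of_nonneg_ae ((hae θ₁).mono fun x hx => hx.1)
      hF.aestronglyMeasurable, integral_eq_lintegral_of_nonneg_ae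
      ((hae θ₂).mono fun x hx => hx.1) hF.aestronglyMeasurable]
  refine (ENNReal.toReal_mono (b := ∫⁻ x, ENNReal.ofReal (F x) ∂(I.law alg θ θ₂ H) +
    ENNReal.ofReal C) (ENNReal.add_ne_top.2 ⟨hFfin θ₂, ENNReal.ofReal_ne_top⟩) ?_).trans_eq ?_
  · have hF' := hF.ennreal_ofReal
    have hW : ∀ η, Measurable fun x : (A → ℝ) × History A H => alg.weight η x.2 := fun η =>
      (alg.measurable_weight η H).comp measurable_snd
    have hB : ∀ᵐ x ∂(baseLaw (I.prior θ) I.reward H), ENNReal.ofReal (F x) ≤ d x.1 := by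
      have hms : MeasurableSet {μ : A → ℝ | ∀ a, m μ ≤ μ a ∧ ENNReal.ofReal (μ a - m μ) ≤ d μ} := by
        refine measurableSet_setOfPred.2 (Measurable.forall fun a => ?_)
        refine measurableSet_setOfPred.1 ((measurableSet_le hm (measurable_pi_apply a)).inter
          (measurableSet_le ?_ hd))
        exact ((measurable_pi_apply a).sub hm).ennreal_ofReal
      filter_upwards [Measure.ae_compProd_of_ae_fst (baseTraj I.reward H) hms hmd] with x hx
      exact (hx _).2
    have hWF : Measurable fun x => alg.weight θ₂ x.2 * ENNReal.ofReal (F x) := (hW θ₂).mul hF'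
    rw [alg.lintegral_law I θ θ₁ H hF', alg.lintegral_law I θ θ₂ H hF']
    refine le_trans ?_ (add_le_add_right hC _)
    rw [← lintegral_add_left hWF]
    refine lintegral_mono_ae (hB.mono fun x hx => ?_)
    calc alg.weight θ₁ x.2 * ENNReal.ofReal (F x)
        ≤ (alg.weight θ₂ x.2 + (alg.weight θ₁ x.2 - alg.weight θ₂ x.2)) *
          ENNReal.ofReal (F x) := by
          gcongr
          exact le_add_tsub
      _ ≤ _ := by
          rw [add_mul, mul_comm (_ - _)]
          gcongr
  · rw [ENNReal.toReal_add (hFfin θ₂) ENNReal.ofReal_ne_top, ENNReal.toReal_ofReal hC0]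

/-- Each of the `H` rewards contributes at most the spread `D μ` of the mean vector, integrated
against the excess of one trajectory law over the other. -/
theorem abs_expReward_sub_le (I : Instance A Θ) (alg : AlgFamily A Θ Ξ) (θ θ' : Θ) {H : ℕ}
    (hR : I.RewardIntegrable alg θ θ H) (hR' : I.RewardIntegrable alg θ θ' H)
    {D : (A → ℝ) → ℝ} (hD : Measurable D)
    (hDint : ∫⁻ μ, ENNReal.ofReal (D μ) ∂(I.prior θ) ≠ ∞)
    (hspread : ∀ᵐ μ ∂(I.prior θ), ∀ a b, μ a - μ b ≤ D μ)
    {C : ℝ} (hC0 : 0 ≤ C)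
    (hC : ∫⁻ x, ENNReal.ofReal (D x.1) * (alg.weight θ x.2 - alg.weight θ' x.2)
      ∂(baseLaw (I.prior θ) I.reward H) ≤ ENNReal.ofReal C)
    (hC' : ∫⁻ x, ENNReal.ofReal (D x.1) * (alg.weight θ' x.2 - alg.weight θ x.2)
      ∂(baseLaw (I.prior θ) I.reward H) ≤ ENNReal.ofReal C) :
    |I.expReward alg θ θ H - I.expReward alg θ θ' H| ≤ H * C := by
  have : Nonempty A := alg.nonempty_action θ
  have hm : Measurable fun μ : A → ℝ => ⨅ a, μ a := Measurable.iInf fun a => measurable_pi_apply a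
  have hd := hD.ennreal_ofReal
  have hmd : ∀ᵐ μ ∂(I.prior θ), ∀ a, (⨅ b, μ b) ≤ μ a ∧
      ENNReal.ofReal (μ a - ⨅ b, μ b) ≤ ENNReal.ofReal (D μ) := by
    filter_upwards [hspread] with μ hμ a
    have h1 : ∀ b, μ a - D μ ≤ μ b := fun b => by linarith [hμ a b]
    refine ⟨ciInf_le ⟨μ a - D μ, by rintro _ ⟨b, rfl⟩; exact h1 b⟩ a, ?_⟩
    refine ENNReal.ofReal_le_ofReal ?_
    linarith [le_ciInf h1]
  unfold Instance.expReward
  rw [integral_finsetSum _ fun h _ => hR h, integral_finsetSum _ fun h _ => hR' h,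
    ← Finset.sum_sub_distrib]
  refine (Finset.abs_sum_le_sum_abs _ _).trans ?_
  refine (Finset.sum_le_card_nsmul _ _ C fun h _ => ?_).trans_eq (by simp)
  obtain ⟨i1, e1⟩ := integral_reward_eq (I.prior θ) I.reward alg.seed (alg.act θ)
    I.mean_reward h (hR h)
  obtain ⟨i2, e2⟩ := integral_reward_eq (I.prior θ) I.reward alg.seed (alg.act θ')
    I.mean_reward h (hR' h)
  have k1 := integral_mean_le I alg θ θ θ' h i1 i2 hm hd hDint hmd hC0 hC
  have k2 := integral_mean_le I alg θ θ' θ h i2 i1 hm hd hDint hmd hC0 hC'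
  unfold Instance.law at k1 k2 ⊢
  rw [e1, e2, abs_le]
  constructor <;> linarith

end Comparison

/-! ### Spread of the mean vector -/

section Diameter
variable {A : Type*}

theorem coe_sub_le_diam (μ : A → ℝ) (a b : A) : ((μ a - μ b : ℝ) : EReal) ≤ diam μ := by
  rw [EReal.coe_sub]
  exact EReal.sub_le_sub (le_iSup (fun a => (μ a : EReal)) a) (iInf_le (fun a => (μ a : EReal)) b)

theorem sub_le_toReal_diam [Finite A] (μ : A → ℝ) (a b : A) : μ a - μ b ≤ (diam μ).toReal := by
  have : Nonempty A := ⟨a⟩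
  obtain ⟨i, hi⟩ := exists_eq_ciSup_of_finite (f := fun a => (μ a : EReal))
  obtain ⟨j, hj⟩ := exists_eq_ciInf_of_finite (f := fun a => (μ a : EReal))
  have h := coe_sub_le_diam μ a b
  have hd : diam μ = ((μ i - μ j : ℝ) : EReal) := by rw [diam, ← hi, ← hj, EReal.coe_sub]
  rw [hd] at h ⊢
  rw [EReal.toReal_coe]
  exact_mod_cast h

end Diameter

section Tails
variable {A : Type*}

/-- Expected excess of a nonnegative variable over a level beyond which its tail is dominated by a
Gaussian and an exponential one. -/
theorem lintegral_excess_le {Ω : Type*} [MeasurableSpace Ω] (P : Measure Ω)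
    [IsProbabilityMeasure P] {X : Ω → ℝ} (hX : Measurable X) {t c σ ν : ℝ} (hc : 0 ≤ c)
    (hσ : 0 < σ) (hν : 0 < ν)
    (htail : ∀ u, 0 < u → P.real {ω | t + u ≤ X ω} ≤
      c * (Real.exp (-(1 / (2 * σ ^ 2)) * u ^ 2) + Real.exp (-(1 / (2 * ν)) * u))) :
    ∫⁻ ω, ENNReal.ofReal (X ω - t) ∂P ≤ ENNReal.ofReal (c * (1.3 * σ + 2 * ν)) := by
  have hb : 0 < 1 / (2 * σ ^ 2) := by positivity
  have hb' : 0 < 1 / (2 * ν) := by positivity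
  have e1 : ∫⁻ ω, ENNReal.ofReal (X ω - t) ∂P = ∫⁻ ω, ENNReal.ofReal (max (X ω - t) 0) ∂P := by
    refine lintegral_congr fun ω => ?_
    rw [ENNReal.ofReal_max, ENNReal.ofReal_zero, max_eq_left zero_le]
  have i1 : IntegrableOn (fun u : ℝ => Real.exp (-(1 / (2 * σ ^ 2)) * u ^ 2)) (Set.Ioi 0) :=
    (integrable_exp_neg_mul_sq hb).integrableOn
  have i2 : IntegrableOn (fun u : ℝ => Real.exp (-(1 / (2 * ν)) * u)) (Set.Ioi 0) :=
    exp_neg_integrableOn_Ioi 0 hb'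
  -- The Gaussian integral is `σ √(π / 2)`, and `π / 2 < 1.3²`.
  have v1 : ∫ u in Set.Ioi (0 : ℝ), Real.exp (-(1 / (2 * σ ^ 2)) * u ^ 2) ≤ 1.3 * σ := by
    rw [integral_gaussian_Ioi, div_le_iff₀ (by norm_num), Real.sqrt_le_left (by positivity)]
    have := Real.pi_lt_d2
    rw [div_div_eq_mul_div, div_one]
    nlinarith [sq_nonneg σ, mul_pos hσ hσ]
  have v2 : ∫ u in Set.Ioi (0 : ℝ), Real.exp (-(1 / (2 * ν)) * u) = 2 * ν := by
    rw [integral_exp_mul_Ioi (by linarith)]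
    simp
  have hpos : 0 ≤ᵐ[P] fun ω => max (X ω - t) 0 :=
    Filter.Eventually.of_forall fun ω => le_max_right _ _
  rw [e1, lintegral_eq_lintegral_meas_le P hpos
    ((hX.sub_const t).max measurable_const).aemeasurable]
  calc ∫⁻ u in Set.Ioi 0, P {ω | u ≤ max (X ω - t) 0}
      ≤ ∫⁻ u in Set.Ioi 0, ENNReal.ofReal (c * (Real.exp (-(1 / (2 * σ ^ 2)) * u ^ 2) +
          Real.exp (-(1 / (2 * ν)) * u))) := by
        refine setLIntegral_mono' measurableSet_Ioi fun u hu => ?_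
        have hu : 0 < u := hu
        rw [← ofReal_measureReal (μ := P)]
        refine ENNReal.ofReal_le_ofReal (le_trans (measureReal_mono ?_) (htail u hu))
        intro ω hω
        have hω : u ≤ max (X ω - t) 0 := hω
        rcases le_max_iff.1 hω with h | h
        · change t + u ≤ X ω
          linarith
        · linarith
    _ = ENNReal.ofReal (∫ u in Set.Ioi 0, c * (Real.exp (-(1 / (2 * σ ^ 2)) * u ^ 2) +
          Real.exp (-(1 / (2 * ν)) * u))) :=
        (ofReal_integral_eq_lintegral_ofReal ((i1.add i2).const_mul c)
          (Filter.Eventually.of_forall fun u =>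
            mul_nonneg hc (add_nonneg (Real.exp_nonneg _) (Real.exp_nonneg _)))).symm
    _ ≤ _ := by
        refine ENNReal.ofReal_le_ofReal ?_
        rw [integral_const_mul, integral_add i1 i2, v2]
        gcongr

/-- Beyond the level `σ √(2L) + 2νL` both tails carry a factor `exp (-L)`; for the Gaussian one this
uses `(x + u)² ≥ x² + u²`. -/
theorem exp_neg_mul_tail_bound {L σ ν u t : ℝ} (hL : 0 ≤ L) (hσ : 0 < σ) (hν : 0 < ν) (hu : 0 < u)
    (ht : t = σ * √(2 * L) + 2 * ν * L) :
    2 * max (Real.exp (-(t + u) ^ 2 / (2 * σ ^ 2))) (Real.exp (-(t + u) / (2 * ν))) ≤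
      2 * Real.exp (-L) *
        (Real.exp (-(1 / (2 * σ ^ 2)) * u ^ 2) + Real.exp (-(1 / (2 * ν)) * u)) := by
  have hs := Real.sq_sqrt (show 0 ≤ 2 * L by positivity)
  have hs0 := Real.sqrt_nonneg (2 * L)
  have h1 : Real.exp (-(t + u) ^ 2 / (2 * σ ^ 2)) ≤
      Real.exp (-L) * Real.exp (-(1 / (2 * σ ^ 2)) * u ^ 2) := by
    rw [← Real.exp_add, Real.exp_le_exp, div_le_iff₀ (by positivity)]
    have h2 : (σ * √(2 * L)) ^ 2 + u ^ 2 ≤ (t + u) ^ 2 := by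
      have : σ * √(2 * L) ≤ t := by rw [ht]; linarith [mul_nonneg hν.le hL]
      have h0 : 0 ≤ σ * √(2 * L) := by positivity
      nlinarith
    rw [mul_pow, hs] at h2
    have : (-L + -(1 / (2 * σ ^ 2)) * u ^ 2) * (2 * σ ^ 2) = -(σ ^ 2 * (2 * L) + u ^ 2) := by
      field_simp
      ring
    rw [this]
    linarith
  have h2 : Real.exp (-(t + u) / (2 * ν)) ≤ Real.exp (-L) * Real.exp (-(1 / (2 * ν)) * u) := by
    rw [← Real.exp_add, Real.exp_le_exp, div_le_iff₀ (by positivity)]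
    have : (-L + -(1 / (2 * ν)) * u) * (2 * ν) = -(2 * ν * L + u) := by
      field_simp
      ring
    rw [this, ht]
    have : 0 ≤ σ * √(2 * L) := by positivity
    linarith
  have := max_le_add_of_nonneg (Real.exp_nonneg (-(t + u) ^ 2 / (2 * σ ^ 2)))
    (Real.exp_nonneg (-(t + u) / (2 * ν)))
  linarith

/-- Numerical comparison of the level and the mean excess with the stated constants. -/
theorem level_add_excess_le {N δ σ ν : ℝ} (hN : 1 ≤ N) (hδ : 0 < δ) (hδ1 : δ ≤ 1) (hσ : 0 < σ)
    (hν : 0 < ν) :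
    2 * (σ * √(2 * Real.log (2 * N / δ)) + 2 * ν * Real.log (2 * N / δ)) +
        2 * (1.3 * σ + 2 * ν) ≤
      σ * (8 + 5 * √(Real.log (N ^ 2 / δ))) + ν * (11 + 7 * Real.log (N ^ 2 / δ)) := by
  set l := Real.log (N ^ 2 / δ) with hl
  have hN0 : 0 < N := by linarith
  have hlN := Real.log_nonneg hN
  have hlδ := Real.log_nonpos hδ.le hδ1
  have hl2 := Real.log_two_lt_d9
  have hl' : l = 2 * Real.log N - Real.log δ := by
    rw [hl, Real.log_div (by positivity) hδ.ne', Real.log_pow]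
    norm_num
  have hL : Real.log (2 * N / δ) = Real.log 2 + Real.log N - Real.log δ := by
    rw [Real.log_div (by positivity) hδ.ne', Real.log_mul (by norm_num) hN0.ne']
  have hl0 : 0 ≤ l := by linarith
  -- `log 2 < 0.7` and `log N ≤ 2 log N`.
  have hLl : Real.log (2 * N / δ) ≤ 0.7 + l := by linarith
  have hs := Real.sq_sqrt hl0
  have hs0 := Real.sqrt_nonneg l
  -- `√(1.4 + 2 l) ≤ √1.4 + √2 √l`, with both constants rounded up.
  have hsq : √(2 * Real.log (2 * N / δ)) ≤ 1.2 + 1.5 * √l := by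
    rw [Real.sqrt_le_left (by positivity)]
    nlinarith
  have h1 := mul_le_mul_of_nonneg_left hsq hσ.le
  have h2 := mul_le_mul_of_nonneg_left hLl hν.le
  have h3 := mul_nonneg hσ.le hs0
  have h4 := mul_nonneg hν.le hl0
  nlinarith

/-- For sub-Gamma tails the spread of the mean vector is at most a constant `k` plus a remainder `e`
that is small on average: `k` collects the spread of the prior mean and the level beyond which each
coordinate deviates with probability at most `δ / |A|` up to a constant factor, and `e` collects the
excesses over this level. -/
theorem IsSubGamma.exists_spread_bound [Finite A] [Nonempty A] {P : Measure (A → ℝ)}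
    [IsProbabilityMeasure P] {σ ν δ : ℝ} (hP : IsSubGamma P σ ν) (hσ : 0 < σ) (hν : 0 < ν)
    (hδ : 0 < δ) (hδ1 : δ ≤ 1) :
    ∃ (k s : ℝ) (e : (A → ℝ) → ℝ), 0 ≤ k ∧ 0 ≤ s ∧ Measurable e ∧ (∀ μ, 0 ≤ e μ) ∧
      (∀ μ a b, μ a - μ b ≤ k + e μ) ∧
      ∫⁻ μ, ENNReal.ofReal (e μ) ∂P ≤ ENNReal.ofReal (δ * s) ∧
      k + s ≤ (diam (meanVec P)).toReal +
        σ * (8 + 5 * √(Real.log ((Nat.card A : ℝ) ^ 2 / δ))) +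
        ν * (11 + 7 * Real.log ((Nat.card A : ℝ) ^ 2 / δ)) := by
  have := Fintype.ofFinite A
  let N : ℝ := Nat.card A
  have hN : 1 ≤ N := Nat.one_le_cast.2 Nat.card_pos
  let L := Real.log (2 * N / δ)
  have hL : 0 ≤ L := Real.log_nonneg ((one_le_div hδ).2 (by linarith))
  have hexp : 2 * Real.exp (-L) = δ / N := by
    rw [Real.exp_neg, Real.exp_log (by positivity)]
    field_simp
  let t := σ * √(2 * L) + 2 * ν * L
  have ht0 : 0 ≤ t := by positivity
  let X : A → (A → ℝ) → ℝ := fun a μ => |μ a - meanVec P a|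
  have hX : ∀ a, Measurable (X a) := fun a => by
    have h1 : Measurable fun μ : A → ℝ => μ a - meanVec P a :=
      (measurable_pi_apply a).sub_const _
    simpa [X, Real.norm_eq_abs] using h1.norm
  have hexcess : ∀ a, ∫⁻ μ, ENNReal.ofReal (X a μ - t) ∂P ≤
      ENNReal.ofReal (δ / N * (1.3 * σ + 2 * ν)) := fun a => by
    refine BayesBandit.lintegral_excess_le P (hX a) (by positivity) hσ hν fun u hu => ?_
    rw [← hexp]
    exact (hP a (t + u) (by linarith)).trans (exp_neg_mul_tail_bound hL hσ hν hu rfl)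
  have hD0 : 0 ≤ (diam (meanVec P)).toReal := by
    have a := Classical.arbitrary A
    simpa using sub_le_toReal_diam (meanVec P) a a
  refine ⟨(diam (meanVec P)).toReal + 2 * t, 2 * (1.3 * σ + 2 * ν),
    fun μ => 2 * ∑ a, max (X a μ - t) 0, by positivity, by positivity, ?_, ?_, ?_, ?_, ?_⟩
  · exact (Finset.measurable_sum _ fun a _ =>
      ((hX a).sub_const t).max measurable_const).const_mul 2
  · exact fun μ => by positivity
  · intro μ a b
    have hs : ∀ a, X a μ ≤ t + ∑ a, max (X a μ - t) 0 := fun a => by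
      have h1 := Finset.single_le_sum (f := fun a => max (X a μ - t) 0)
        (fun a _ => le_max_right _ _) (Finset.mem_univ a)
      have h2 := le_max_left (X a μ - t) 0
      linarith
    have h1 := sub_le_toReal_diam (meanVec P) a b
    have h2 := le_abs_self (μ a - meanVec P a)
    have h3 := neg_le_abs (μ b - meanVec P b)
    have h4 := hs a
    have h5 := hs b
    dsimp only [X] at h4 h5 ⊢
    linarith
  · have hconv : ∀ μ, ENNReal.ofReal (2 * ∑ a, max (X a μ - t) 0) =
        2 * ∑ a, ENNReal.ofReal (X a μ - t) := fun μ => by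
      rw [ENNReal.ofReal_mul (by norm_num), ENNReal.ofReal_ofNat,
        ENNReal.ofReal_sum_of_nonneg fun a _ => le_max_right _ _]
      simp_rw [ENNReal.ofReal_max, ENNReal.ofReal_zero, max_eq_left zero_le]
    have hXm : ∀ a, Measurable fun μ => ENNReal.ofReal (X a μ - t) :=
      fun a => ((hX a).sub_const t).ennreal_ofReal
    simp_rw [hconv]
    rw [lintegral_const_mul _ (Finset.measurable_sum _ fun a _ => hXm a),
      lintegral_finsetSum _ fun a _ => hXm a]
    calc _ ≤ 2 * ∑ _a : A, ENNReal.ofReal (δ / N * (1.3 * σ + 2 * ν)) := by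
          gcongr
          exact hexcess _
      _ = _ := by
          rw [Finset.sum_const, nsmul_eq_mul, Finset.card_univ, ← Nat.card_eq_fintype_card,
            ← ENNReal.ofReal_natCast, ← ENNReal.ofReal_mul (by positivity),
            ← ENNReal.ofReal_ofNat, ← ENNReal.ofReal_mul (by norm_num)]
          congr 1
          change 2 * (N * _) = _
          field_simp
  · have := level_add_excess_le hN hδ hδ1 hσ hν
    dsimp only [t, L]
    linarith

theorem IsSubGaussian.isSubGamma {P : Measure (A → ℝ)} {σ : ℝ} (hP : IsSubGaussian P σ) (ν : ℝ) :
    IsSubGamma P σ ν := fun a t ht =>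
  (hP a t ht).trans (mul_le_mul_of_nonneg_left (le_max_left _ _) (by norm_num))

end Tails

/-! ### Bounds for bounded and for sub-Gamma priors -/

section Bounds
variable {A Θ Ξ : Type*} [MeasurableSpace A] [MeasurableSpace Ξ] [Countable A]
  [DiscreteMeasurableSpace A]

theorem abs_expReward_sub_le_of_isBounded (I : Instance A Θ) (alg : AlgFamily A Θ Ξ) (θ θ' : Θ)
    {H : ℕ} (hR : I.RewardIntegrable alg θ θ H) (hR' : I.RewardIntegrable alg θ θ' H)
    {x : ℝ} (hx0 : 0 ≤ x)
    (hx : ∫⁻ z, (alg.weight θ z.2 - alg.weight θ' z.2)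
      ∂(baseLaw (I.prior θ) I.reward H) ≤ ENNReal.ofReal x)
    (hx' : ∫⁻ z, (alg.weight θ' z.2 - alg.weight θ z.2)
      ∂(baseLaw (I.prior θ) I.reward H) ≤ ENNReal.ofReal x)
    {B : ℝ} (hB : IsBounded (I.prior θ) B) :
    |I.expReward alg θ θ H - I.expReward alg θ θ' H| ≤ H * (B * x) := by
  obtain ⟨a⟩ := alg.nonempty_action θ
  have hsp : ∀ᵐ μ ∂(I.prior θ), ∀ a b, μ a - μ b ≤ B := by
    filter_upwards [hB] with μ hμ a b
    exact_mod_cast (coe_sub_le_diam μ a b).trans hμ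
  have hB0 : 0 ≤ B := by
    obtain ⟨μ, hμ⟩ := hsp.exists
    simpa using hμ a a
  have hm : ∀ η, Measurable fun z : (A → ℝ) × History A H => alg.weight η z.2 := fun η =>
    (alg.measurable_weight η H).comp measurable_snd
  have hsub : ∀ η η', Measurable fun z : (A → ℝ) × History A H =>
    alg.weight η z.2 - alg.weight η' z.2 := fun η η' => (hm η).sub (hm η')
  refine abs_expReward_sub_le I alg θ θ' hR hR' (D := fun _ => B) measurable_const (by simp) hsp
    (by positivity) ?_ ?_
  · rw [lintegral_const_mul _ (hsub θ θ'), ENNReal.ofReal_mul hB0]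
    gcongr
  · rw [lintegral_const_mul _ (hsub θ' θ), ENNReal.ofReal_mul hB0]
    gcongr

theorem abs_expReward_sub_le_of_isSubGamma [Finite A] (I : Instance A Θ) (alg : AlgFamily A Θ Ξ)
    (θ θ' : Θ) {H : ℕ} (hR : I.RewardIntegrable alg θ θ H) (hR' : I.RewardIntegrable alg θ θ' H)
    {x : ℝ} (hx0 : 0 ≤ x)
    (hx : ∫⁻ z, (alg.weight θ z.2 - alg.weight θ' z.2)
      ∂(baseLaw (I.prior θ) I.reward H) ≤ ENNReal.ofReal x)
    (hx' : ∫⁻ z, (alg.weight θ' z.2 - alg.weight θ z.2)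
      ∂(baseLaw (I.prior θ) I.reward H) ≤ ENNReal.ofReal x)
    {σ ν : ℝ} (hσ : 0 < σ) (hν : 0 < ν) (hP : IsSubGamma (I.prior θ) σ ν) :
    |I.expReward alg θ θ H - I.expReward alg θ θ' H| ≤
      H * (x * ((diam (meanVec (I.prior θ))).toReal +
        σ * (8 + 5 * √(Real.log ((Nat.card A : ℝ) ^ 2 / min 1 x))) +
        ν * (11 + 7 * Real.log ((Nat.card A : ℝ) ^ 2 / min 1 x)))) := by
  have : Nonempty A := alg.nonempty_action θ
  have hm : ∀ η, Measurable fun z : (A → ℝ) × History A H => alg.weight η z.2 := fun η =>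
    (alg.measurable_weight η H).comp measurable_snd
  have hsub : ∀ η η', Measurable fun z : (A → ℝ) × History A H =>
    alg.weight η z.2 - alg.weight η' z.2 := fun η η' => (hm η).sub (hm η')
  -- If `x = 0`, the two trajectory laws coincide; the level of the spread bound is then irrelevant.
  obtain ⟨δ, hδ, hδ1, hδx⟩ : ∃ δ : ℝ, 0 < δ ∧ δ ≤ 1 ∧ (x = 0 ∨ δ = min 1 x) := by
    rcases hx0.eq_or_lt with h | h
    · exact ⟨1, one_pos, le_rfl, Or.inl h.symm⟩
    · exact ⟨min 1 x, lt_min one_pos h, min_le_left _ _, Or.inr rfl⟩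
  obtain ⟨k, s, e, hk, hs, he, he0, hspread, heint, hks⟩ := hP.exists_spread_bound hσ hν hδ hδ1
  have hDint : ∫⁻ μ, ENNReal.ofReal (k + e μ) ∂(I.prior θ) ≠ ∞ := by
    simp_rw [ENNReal.ofReal_add hk (he0 _)]
    rw [lintegral_add_left measurable_const]
    refine ENNReal.add_ne_top.2 ⟨by simp, (heint.trans_lt ENNReal.ofReal_lt_top).ne⟩
  have hmain : ∀ θ₁ θ₂, ∫⁻ z, (alg.weight θ₁ z.2 - alg.weight θ₂ z.2)
      ∂(baseLaw (I.prior θ) I.reward H) ≤ ENNReal.ofReal x →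
      ∫⁻ z, ENNReal.ofReal (k + e z.1) * (alg.weight θ₁ z.2 - alg.weight θ₂ z.2)
        ∂(baseLaw (I.prior θ) I.reward H) ≤ ENNReal.ofReal (min 1 x * (k + s)) := by
    intro θ₁ θ₂ h
    rcases hδx with rfl | hδx
    · rw [ENNReal.ofReal_zero, nonpos_iff_eq_zero, lintegral_eq_zero_iff (hsub θ₁ θ₂)] at h
      refine (lintegral_eq_zero_iff'
        ((he.const_add k).ennreal_ofReal.comp measurable_fst |>.mul
          (hsub θ₁ θ₂)).aemeasurable).2 ?_ |>.trans_le zero_le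
      filter_upwards [h] with z hz
      have hz : alg.weight θ₁ z.2 - alg.weight θ₂ z.2 = 0 := hz
      simp [hz]
    · have h1 : ∫⁻ z, (alg.weight θ₁ z.2 - alg.weight θ₂ z.2)
          ∂(baseLaw (I.prior θ) I.reward H) ≤ ENNReal.ofReal δ := by
        rw [hδx, ENNReal.ofReal_min]
        refine le_min ?_ h
        rw [ENNReal.ofReal_one, ← alg.lintegral_weight I θ θ₁ H]
        exact lintegral_mono fun z => tsub_le_self
      have he' : Measurable fun z : (A → ℝ) × History A H => ENNReal.ofReal (e z.1) :=
        he.ennreal_ofReal.comp measurable_fst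
      calc _ ≤ ∫⁻ z, (ENNReal.ofReal k * (alg.weight θ₁ z.2 - alg.weight θ₂ z.2) +
            alg.weight θ₁ z.2 * ENNReal.ofReal (e z.1)) ∂(baseLaw (I.prior θ) I.reward H) := by
            refine lintegral_mono fun z => ?_
            rw [ENNReal.ofReal_add hk (he0 _), add_mul, mul_comm (alg.weight θ₁ z.2)]
            gcongr
            exact tsub_le_self
        _ = ENNReal.ofReal k * ∫⁻ z, (alg.weight θ₁ z.2 - alg.weight θ₂ z.2)
              ∂(baseLaw (I.prior θ) I.reward H) +
            ∫⁻ μ, ENNReal.ofReal (e μ) ∂(I.prior θ) := by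
            rw [lintegral_add_left ((hsub θ₁ θ₂).const_mul _),
              lintegral_const_mul _ (hsub θ₁ θ₂), ← alg.lintegral_law I θ θ₁ H he',
              I.lintegral_fst_law alg θ θ₁ H he.ennreal_ofReal]
        _ ≤ ENNReal.ofReal k * ENNReal.ofReal δ + ENNReal.ofReal (δ * s) := by gcongr
        _ = _ := by
            rw [← hδx, ← ENNReal.ofReal_mul hk, ← ENNReal.ofReal_add (by positivity)
              (by positivity)]
            congr 1
            ring
  refine (abs_expReward_sub_le I alg θ θ' hR hR' (he.const_add k) hDint
    (Filter.Eventually.of_forall hspread) (C := min 1 x * (k + s)) (by positivity)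
    (hmain θ θ' hx) (hmain θ' θ hx')).trans ?_
  rcases hδx with rfl | hδx
  · simp
  · rw [← hδx]
    have hδx' : δ ≤ x := hδx ▸ min_le_right _ _
    gcongr

end Bounds
end BayesBandit

theorem mainTheorem1 {A Θ Ξ : Type*}
    [Countable A] [MeasurableSpace A] [DiscreteMeasurableSpace A] [MeasurableSpace Ξ]
    (I : BayesBandit.Instance A Θ) (alg : BayesBandit.AlgFamily A Θ Ξ)
    (post : Θ → (h : ℕ) → Kernel (BayesBandit.History A h) (A → ℝ))
    (hpost : ∀ θ, BayesBandit.IsPosterior (I.prior θ) I.reward (post θ))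
    (H : ℕ) (n : ℝ) (hn : 0 < n) (hMC : alg.IsMonteCarlo post H n)
    (θ θ' : Θ)
    (hR : I.RewardIntegrable alg θ θ H) (hR' : I.RewardIntegrable alg θ θ' H)
    (ε : ℝ) (hε : ε = BayesBandit.tv (I.prior θ) (I.prior θ')) :
    (∀ B : ℝ, BayesBandit.IsBounded (I.prior θ) B →
      |I.expReward alg θ θ H - I.expReward alg θ θ' H| ≤ 2 * n * H ^ 2 * ε * B) ∧
    (∀ σ : ℝ, Finite A → 0 < σ → BayesBandit.IsSubGaussian (I.prior θ) σ →
      |I.expReward alg θ θ H - I.expReward alg θ θ' H| ≤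
        2 * n * H ^ 2 * ε *
          ((BayesBandit.diam (BayesBandit.meanVec (I.prior θ))).toReal +
            σ * (8 + 5 * √(Real.log ((Nat.card A : ℝ) ^ 2 / min 1 (2 * n * H * ε)))))) ∧
    (∀ σ ν : ℝ, Finite A → 0 < σ → 0 < ν → BayesBandit.IsSubGamma (I.prior θ) σ ν →
      |I.expReward alg θ θ H - I.expReward alg θ θ' H| ≤
        2 * n * H ^ 2 * ε *
          ((BayesBandit.diam (BayesBandit.meanVec (I.prior θ))).toReal +
            σ * (8 + 5 * √(Real.log ((Nat.card A : ℝ) ^ 2 / min 1 (2 * n * H * ε)))) +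
            ν * (11 + 7 * Real.log ((Nat.card A : ℝ) ^ 2 / min 1 (2 * n * H * ε))))) := by
  open BayesBandit in
  have hε0 : 0 ≤ ε := hε ▸ tv_nonneg _ _
  have hx0 : 0 ≤ 2 * n * H * ε := by positivity
  have hov := alg.one_le_overlap_add I hpost hn hMC θ θ' (le_refl H)
  rw [← hε] at hov
  have hx := alg.lintegral_weight_sub_le I θ θ θ' H hov
  have hov' : 1 ≤ alg.overlap I θ θ' θ H + ENNReal.ofReal (2 * n * H * ε) := by
    simpa only [AlgFamily.overlap, min_comm] using hov
  have hx' := alg.lintegral_weight_sub_le I θ θ' θ H hov'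
  have hgamma : ∀ σ ν : ℝ, Finite A → 0 < σ → 0 < ν → IsSubGamma (I.prior θ) σ ν →
      |I.expReward alg θ θ H - I.expReward alg θ θ' H| ≤
        2 * n * H ^ 2 * ε * ((diam (meanVec (I.prior θ))).toReal +
          σ * (8 + 5 * √(Real.log ((Nat.card A : ℝ) ^ 2 / min 1 (2 * n * H * ε)))) +
          ν * (11 + 7 * Real.log ((Nat.card A : ℝ) ^ 2 / min 1 (2 * n * H * ε)))) := by
    intro σ ν _ hσ hν hP
    refine (abs_expReward_sub_le_of_isSubGamma I alg θ θ' hR hR' hx0 hx hx' hσ hν hP).trans_eq ?_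
    ring
  refine ⟨fun B hB => ?_, fun σ hA hσ hP => ?_, hgamma⟩
  · refine (abs_expReward_sub_le_of_isBounded I alg θ θ' hR hR' hx0 hx hx' hB).trans_eq ?_
    ring
  · -- A sub-Gaussian prior is `(σ², ν)`-sub-Gamma for every `ν > 0`; let `ν` tend to `0`.
    refine le_of_forall_pos_le_add fun η hη => ?_
    set l := Real.log ((Nat.card A : ℝ) ^ 2 / min 1 (2 * n * H * ε))
    set c := 2 * n * H ^ 2 * ε * (11 + 7 * l) with hc
    have hc1 : 0 < |c| + 1 := by positivity
    have h := hgamma σ (η / (|c| + 1)) hA hσ (by positivity) (hP.isSubGamma _)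
    have hcη : c * (η / (|c| + 1)) ≤ η := by
      rw [mul_div_assoc', div_le_iff₀ hc1]
      nlinarith [le_abs_self c]
    rw [mul_add, mul_left_comm, ← hc, mul_comm _ c] at h
    linarith
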